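/- **Theorem (A–VCG3, revenue regret).** *Model.* There are $N$ ads and $K$ slots, $1\le K<N$, and $T$ rounds. Ad $i$ has quality $q_i\in[0,1]$ and reported value $\hat v_i\in[0,v_{\max}]$. In each round an independent user scans the slots from the top, goes on from slot $l$ to slot $l+1$ with probability $\lambda_l\in[0,1]$, and clicks an observed ad $i$ with probability $q_i$. So slot $m$ is observed with probability $\Lambda_m=\prod_{l<m}\lambda_l$ if $m\le K$, and $\Lambda_m=0$ if $m>K$. An allocation $\theta$ is a bijection between ads and the slots $1,\dots,N$ (slots $m>K$ are not displayed); $\pi(i;\theta)$ is the slot of ad $i$. The social welfare is $\mathrm{SW}(\theta)=\sum_i\Lambda_{\pi(i;\theta)}q_i\hat v_i$. Let $\theta^*$ maximize it. The expected VCG payments are $p_i^*=\max_\theta \sum_{j\ne i}\Lambda_{\pi(j;\theta)}q_j\hat v_j-\sum_{j\ne i}\Lambda_{\pi(j;\theta^*)}q_j\hat v_j$. *Mechanism* (inputs $\tau,\delta,\mu$; neither the $q_i$ nor the $\Lambda_m$ are used). In the exploration rounds $t=1,\dots,\tau$ slot $m$ holds ad $((t+m-1)\bmod N)+1$ and nobody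 pays. Then $\tilde q_i$ is the average of the clicks on ad $i$ over the exploration rounds in which it was in the first slot (and $0$ if there are none), and $\tilde q_i^+=\tilde q_i+\eta$ with $\eta=\sqrt{\tfrac N\tau\log\tfrac{2N}\delta}$. In each round $t=\tau+1,\dots,T$, every report is independently passed through the canonical self-resampling procedure: with probability $1-\mu$, $(x_i,y_i)=(\hat v_i,\hat v_i)$; otherwise $y_i$ is uniform on $[0,\hat v_i]$ and $x_i=\mathrm{rec}(y_i)$, where $\mathrm{rec}(c)$ returns $c$ with probability $1-\mu$ and otherwise returns $\mathrm{rec}(c')$ for a fresh $c'$ uniform on $[0,c]$. The ads are displayed in decreasing order of $\tilde q_i^+x_i$ (ties broken by any measurable rule), and ad $i$ pays, if it is clicked, $\hat v_i$ when $y_i=\hat v_i$ and $\hat v_i-\hat v_i/\mu$ when $y_i<\hat v_i$. Let $p_{i,t}$ be the payment of ad $i$ in round $t$ in expectation over the clicks of that round ($p_{i,t}=0$ for $t\le\tau$). The regret is $$R_T=\mathbb E\Big[T\sum_{i=1}^N p_i^*-\sum_{t=1}^T\sum_{i=1}^N p_{i,t}\Big],$$ the expectation being over the clicks and the randomness of the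 mechanism. *Claim.* For all integers $1\le\tau\le T$, all $\delta\in(0,1]$ and all $\mu\in(0,1)$, $$R_T\le v_{\max}K\big[(T-\tau)(2\eta+2\mu N)+\tau+\delta T\big].$$ Moreover, if $T\ge N$, $\mu=N^{-2/3}T^{-1/3}$, $\delta=N^{1/3}T^{-1/3}$, and $\tau=T^{2/3}N^{1/3}\big(\log\tfrac{2N}\delta\big)^{1/3}$, truncated at $T$ and rounded to an integer (that is, $\tau\le T$ is an integer with $\big|\tau-\min\{T^{2/3}N^{1/3}(\log\tfrac{2N}\delta)^{1/3},\,T\}\big|<1$), then $$R_T\le 6\,v_{\max}K\,T^{2/3}N^{1/3}\big(\log(2N^{2/3}T^{1/3})\big)^{1/3}.$$ -/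

import Mathlib

open MeasureTheory ProbabilityTheory

namespace AVCG3

/-! ## Position-dependent cascade auctions -/

/-- A sponsored search auction with `N` ads and `K` slots and only position-dependent
externalities. Slots and ads are numbered from `0`; the extended slots `m ≥ K` are those where
ads are not displayed. `lam l` is the prominence: the probability that a user who observed slot `l`
goes on to observe slot `l + 1`. -/
structure Auction (N K : ℕ) where
  /-- the prominences of the slots -/
  lam : Fin K → unitInterval
  /-- the qualities of the ads: probability of a click once the ad is observed -/
  q : Fin N → unitInterval
  /-- the reported values of the advertisers -/
  bid : Fin N → ℝ

/-- An allocation maps each (extended) slot to the ad it holds; its inverse `θ.symm` maps each ad to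
its slot. -/
abbrev Allocation (N : ℕ) := Equiv.Perm (Fin N)

variable {N K : ℕ}

namespace Auction

/-- The probability that slot `m` is observed: the product of the prominences of the slots above it
if `m < K`, and `0` otherwise. -/
noncomputable def Lam (A : Auction N K) (m : Fin N) : ℝ :=
  if m.val < K then ∏ l : Fin K with l.val < m.val, (A.lam l : ℝ) else 0

/-- The expected value that ad `i` gets from allocation `θ`. -/
noncomputable def value (A : Auction N K) (θ : Allocation N) (i : Fin N) : ℝ :=
  A.Lam (θ.symm i) * A.q i * A.bid i

/-- Social welfare of `θ` with respect to the reports. -/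
noncomputable def socialWelfare (A : Auction N K) (θ : Allocation N) : ℝ :=
  ∑ i, A.value θ i

/-- Social welfare of all the ads but `i`. -/
noncomputable def socialWelfareWithout (A : Auction N K) (i : Fin N) (θ : Allocation N) : ℝ :=
  ∑ j with j ≠ i, A.value θ j

/-- `θ` is efficient: it maximizes the social welfare with respect to the reports. -/
def IsEfficient (A : Auction N K) (θ : Allocation N) : Prop :=
  ∀ θ', A.socialWelfare θ' ≤ A.socialWelfare θ

/-- Expected VCG payment of ad `i` when the efficient allocation `θ` is chosen: the largest social
welfare the other ads could get if `i` were absent, minus the social welfare they get in `θ`. -/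
noncomputable def vcgPayment (A : Auction N K) (θ : Allocation N) (i : Fin N) : ℝ :=
  (⨆ θ', A.socialWelfareWithout i θ') - A.socialWelfareWithout i θ

end Auction

/-! ## Users and clicks -/

/-- The behaviour of the user of one round: for each slot, whether a user observing it
goes on to the next one; for each ad, whether a user observing it clicks on it. -/
abbrev User (N K : ℕ) := (Fin K → Bool) × (Fin N → Bool)

/-- Law of the user: independent transitions (a Markov chain over the slots) and clicks. -/
noncomputable def userLaw (A : Auction N K) : Measure (User N K) :=
  (Measure.pi fun l => bernoulliMeasure true false (A.lam l)).prod
    (Measure.pi fun i => bernoulliMeasure true false (A.q i))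

open Classical in
/-- Click indicator: ad `i` is clicked under `θ` iff it is displayed, the user goes past
all the slots above it, and the user clicks on it once observed. -/
noncomputable def click (θ : Allocation N) (i : Fin N) (u : User N K) : ℝ :=
  if (θ.symm i).val < K ∧ (∀ l : Fin K, l.val < (θ.symm i).val → u.1 l = true) ∧ u.2 i = true
  then 1 else 0

/-! ## Canonical self-resampling -/

/-- Random seed of the canonical self-resampling procedure: the number of times the procedure
resamples before it keeps the current value, and the uniform draws it uses. -/
abbrev Seed := ℕ × (ℕ → unitInterval)

/-- At each step the current value is resampled with probability `μ` and kept with probability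
`1 - μ`, so the number of resamplings equals `n` with probability `(1 - μ) * μ ^ n`. The draws are
i.i.d. uniform on `[0, 1]`. -/
noncomputable def seedLaw (μ : unitInterval) : Measure Seed :=
  (geometricMeasure (unitInterval.symm μ)).prod
    (Measure.infinitePi fun _ : ℕ => (volume : Measure unitInterval))

/-- First output of the procedure on bid `b`: each resampling replaces the current value `c` by a
uniform draw from `[0, c]`. -/
noncomputable def resampX (b : ℝ) (s : Seed) : ℝ :=
  b * ∏ k ∈ Finset.range s.1, (s.2 k : ℝ)

/-- Second output of the procedure on bid `b`: `b` itself if it is kept at once, and otherwise the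
first resampled value, uniform on `[0, b]`. -/
noncomputable def resampY (b : ℝ) (s : Seed) : ℝ :=
  if s.1 = 0 then b else b * (s.2 0 : ℝ)

/-! ## The mechanism -/

/-- An allocation rule that, given quality estimates `e` and values `x`, displays the ads in
decreasing order of `e i * x i`; ties are broken arbitrarily, up to measurability. -/
structure IsRankingRule (f : (Fin N → ℝ) → (Fin N → ℝ) → Allocation N) : Prop where
  sorted : ∀ e x : Fin N → ℝ, Antitone fun m : Fin N => e (f e x m) * x (f e x m)
  measurable : ∀ θ : Allocation N, MeasurableSet {p : (Fin N → ℝ) × (Fin N → ℝ) | f p.1 p.2 = θ}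

/-- Exploration allocation of the `(t + 1)`-st round: slot `m` (from `0`) holds the ad
`(m + t + 1) mod N` (from `0`). -/
def exploreAlloc (N t : ℕ) : Allocation N := finRotate N ^ (t + 1)

/-- Rounds of the exploration phase (the first `τ` rounds) in which ad `i` is in the first slot. -/
def firstSlotRounds {T : ℕ} (τ : ℕ) (i : Fin N) : Finset (Fin T) :=
  {t | t.val < τ ∧ ((exploreAlloc N t).symm i).val = 0}

/-- Empirical quality of ad `i`: the average of its first-slot clicks during exploration. -/
noncomputable def qualityEstimate {T : ℕ} (τ : ℕ) (u : Fin T → User N K) (i : Fin N) : ℝ :=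
  (∑ t ∈ firstSlotRounds τ i, click (exploreAlloc N t) i (u t)) /
    ((firstSlotRounds τ i : Finset (Fin T)).card : ℝ)

/-- Width of the confidence interval. -/
noncomputable def eta (N τ : ℕ) (δ : ℝ) : ℝ :=
  √((N : ℝ) / τ * Real.log (2 * N / δ))

/-- Upper confidence bound on the quality of ad `i`. -/
noncomputable def upperQuality {T : ℕ} (τ : ℕ) (δ : ℝ) (u : Fin T → User N K) (i : Fin N) : ℝ :=
  qualityEstimate τ u i + eta N τ δ

/-- What ad `i` is asked to pay in an exploitation round with estimates `e`, seeds `s` and user `w`: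
the ads are ranked with the resampled reports, and `i` pays only if it is clicked, in
which case it pays its report, minus `1 / μ` times its report if `y i < bid i`. -/
noncomputable def clickPayment (A : Auction N K)
    (f : (Fin N → ℝ) → (Fin N → ℝ) → Allocation N) (μ : unitInterval)
    (e : Fin N → ℝ) (s : Fin N → Seed) (i : Fin N) (w : User N K) : ℝ :=
  click (f e fun j => resampX (A.bid j) (s j)) i w *
    (A.bid i - if resampY (A.bid i) (s i) < A.bid i then 1 / (μ : ℝ) * A.bid i else 0)

/-- A run of the mechanism over `T` rounds: in each round, a user and a seed for each ad. -/
abbrev Run (N K T : ℕ) := Fin T → User N K × (Fin N → Seed)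

/-- All users and seeds are independent. -/
noncomputable def runLaw (A : Auction N K) (μ : unitInterval) (T : ℕ) : Measure (Run N K T) :=
  Measure.pi fun _ => (userLaw A).prod (Measure.pi fun _ => seedLaw μ)

/-- Payment of ad `i` prescribed in round `t`, in expectation over the clicks of that round: zero
during exploration. It is random, through the exploration clicks and the seeds of round `t`. -/
noncomputable def roundPayment (A : Auction N K)
    (f : (Fin N → ℝ) → (Fin N → ℝ) → Allocation N) (μ : unitInterval)
    {T : ℕ} (τ : ℕ) (δ : ℝ) (i : Fin N) (t : Fin T) (ω : Run N K T) : ℝ :=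
  if t.val < τ then 0
  else ∫ w, clickPayment A f μ (upperQuality τ δ fun r => (ω r).1) (ω t).2 i w ∂(userLaw A)

/-- Expected cumulative revenue regret over `T` rounds with respect to the VCG mechanism that knows
all the parameters and chooses the efficient allocation `θ`. -/
noncomputable def regret (A : Auction N K) (θ : Allocation N)
    (f : (Fin N → ℝ) → (Fin N → ℝ) → Allocation N) (μ : unitInterval)
    (T τ : ℕ) (δ : ℝ) : ℝ :=
  ∫ ω, (T * ∑ i, A.vcgPayment θ i - ∑ t, ∑ i, roundPayment A f μ τ δ i t ω) ∂(runLaw A μ T)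

end AVCG3

/-!
The payments charged by the self-resampling procedure are, in expectation over the seeds, the
truthful payments of the randomized ranking (`integral_netPayment`). Indeed, conditionally on being
resampled, a report is replaced by the self-resampling of a uniform draw below it, so the rebate
`1 / μ` is an unbiased estimate of the integral of the click probability over lower reports
(`integral_seedLaw_resampled`). Writing `rankGain` for the probability of observation that an ad
loses when its report is multiplied by a uniform factor, the revenue of a round is the sum of
`q i * bid i * 𝔼 rankGain`. As the ranking is monotone in each report, `rankGain` is nonnegative for
every seed; and with probability at least `1 - μ * N` no report is resampled. Hence resampling costs
at most a fraction `μ * N` of the revenue, and the expected revenue of an exploitation round is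
nonnegative whatever the estimates are.

Without resampling, the truthful payment of ad `i` in the ranking by `e i * bid i` is, up to the
factor `q i / e i`, the externality `vcgTail` of its slot: the sum over lower slots `l` of
`(Λ (l - 1) - Λ l)` times the score of the ad in slot `l` (`vcgTail_le_rankGain`). The total
externality is monotone in the sorted sequence of scores, hence in the scores. So, when
`q ≤ e ≤ q + 2 * η`, the total for `e` is at least the total for `q`, which by the rearrangement
inequality bounds the Vickrey–Clarke–Groves revenue (`sum_vcgPayment_le`), and the factors
`q i / e i` cost at most `2 * η * vmax * K` (`sum_vcgPayment_sub_le`).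

The estimates satisfy `q ≤ e ≤ q + 2 * η` with probability at least `1 - δ` by Hoeffding's
inequality (`measure_inaccurate_le`): each ad is in the first slot in at least `τ / (2 * N)`
exploration rounds when `τ ≥ N`, and `η ≥ 1` otherwise. The estimates are independent of the seeds
of later rounds, so an exploitation round loses at most `vmax * K * (2 * η + μ * N + δ)`, and an
exploration round at most `vmax * K`. The coefficient of `μ * N` is half the one in the first bound,
which leaves the room needed for the constant `6` in the second bound.
-/

namespace AVCG3

variable {N K : ℕ}

/-! ### Observation probabilities -/

namespace Auction

/-- The observation probability of slot `m`, with the slots indexed by `ℕ`. -/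
noncomputable def lamNat (A : Auction N K) (m : ℕ) : ℝ :=
  if m < K then ∏ l : Fin K with l.val < m, (A.lam l : ℝ) else 0

lemma Lam_eq_lamNat (A : Auction N K) (m : Fin N) : A.Lam m = A.lamNat m := rfl

lemma lamNat_nonneg (A : Auction N K) (m : ℕ) : 0 ≤ A.lamNat m := by
  unfold lamNat
  split_ifs
  · exact Finset.prod_nonneg fun l _ => (A.lam l).2.1
  · exact le_rfl

lemma lamNat_le_one (A : Auction N K) (m : ℕ) : A.lamNat m ≤ 1 := by
  unfold lamNat
  split_ifs
  · exact Finset.prod_le_one (fun l _ => (A.lam l).2.1) fun l _ => (A.lam l).2.2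
  · exact zero_le_one

lemma lamNat_antitone (A : Auction N K) : Antitone A.lamNat := by
  intro m m' h
  unfold lamNat
  split_ifs with h1 h2 h2
  · rw [← Finset.prod_sdiff (s₁ := {l : Fin K | l.val < m}) (s₂ := {l : Fin K | l.val < m'})
      (fun l hl => by simp at hl ⊢; omega)]
    refine mul_le_of_le_one_left (Finset.prod_nonneg fun l _ => (A.lam l).2.1) ?_
    exact Finset.prod_le_one (fun l _ => (A.lam l).2.1) fun l _ => (A.lam l).2.2
  · omega
  · exact Finset.prod_nonneg fun l _ => (A.lam l).2.1
  · exact le_rfl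

lemma Lam_nonneg (A : Auction N K) (m : Fin N) : 0 ≤ A.Lam m := A.lamNat_nonneg m

lemma Lam_le_one (A : Auction N K) (m : Fin N) : A.Lam m ≤ 1 := A.lamNat_le_one m

lemma Lam_antitone (A : Auction N K) : Antitone A.Lam := fun _ _ h => A.lamNat_antitone h

lemma sum_Lam_le (A : Auction N K) : ∑ m : Fin N, A.Lam m ≤ K := by
  have h1 : ∀ m : Fin N, A.Lam m ≤ if m.val < K then 1 else 0 := by
    intro m
    split_ifs with h
    · exact A.Lam_le_one m
    · simp [Lam, h]
  refine (Finset.sum_le_sum fun m _ => h1 m).trans ?_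
  rw [Finset.sum_boole]
  norm_cast
  calc _ = (Finset.image Fin.val {m : Fin N | m.val < K}).card :=
        (Finset.card_image_of_injective _ Fin.val_injective).symm
    _ ≤ (Finset.range K).card := Finset.card_le_card (by
        intro k hk
        simp at hk ⊢
        obtain ⟨a, ha, rfl⟩ := hk
        exact ha)
    _ = K := Finset.card_range K

lemma sum_Lam_symm_le (A : Auction N K) (θ : Allocation N) : ∑ i, A.Lam (θ.symm i) ≤ K := by
  rw [Equiv.sum_comp θ.symm A.Lam]
  exact A.sum_Lam_le

/-! ### The Vickrey–Clarke–Groves payments -/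

/-- If `w l` is the score of the ad in slot `l` of a ranking, `A.vcgTail w m` is the externality
that the ad in slot `m` imposes: without it, each ad below moves up one slot. -/
noncomputable def vcgTail (A : Auction N K) (w : Fin N → ℝ) (m : Fin N) : ℝ :=
  ∑ l with m < l, (A.lamNat (l.val - 1) - A.lamNat l) * w l

lemma lamNat_pred_sub_nonneg (A : Auction N K) (l : ℕ) : 0 ≤ A.lamNat (l - 1) - A.lamNat l :=
  sub_nonneg.2 (A.lamNat_antitone (Nat.sub_le _ _))

lemma vcgTail_mono (A : Auction N K) {w w' : Fin N → ℝ} (h : w ≤ w') (m : Fin N) :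
    A.vcgTail w m ≤ A.vcgTail w' m :=
  Finset.sum_le_sum fun l _ => mul_le_mul_of_nonneg_left (h l) (A.lamNat_pred_sub_nonneg _)

lemma socialWelfareWithout_add_value (A : Auction N K) (i : Fin N) (θ : Allocation N) :
    A.socialWelfareWithout i θ + A.value θ i = A.socialWelfare θ := by
  unfold socialWelfareWithout socialWelfare
  rw [← Finset.sum_erase_add _ _ (Finset.mem_univ i)]
  congr 2
  ext j; simp

/-- By the rearrangement inequality, the best allocation for the ads other than `i` is the ranking
with `i` moved to the last slot. -/
lemma socialWelfareWithout_le (A : Auction N K) (hb : ∀ i, 0 ≤ A.bid i) {σ : Allocation N}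
    (hσ : Antitone fun l => (A.q (σ l) : ℝ) * A.bid (σ l)) (i : Fin N) (θ : Allocation N) :
    A.socialWelfareWithout i θ ≤ A.socialWelfareWithout i σ +
      A.vcgTail (fun l => A.q (σ l) * A.bid (σ l)) (σ.symm i) := by
  obtain _ | n := N
  · exact i.elim0
  set w : Fin (n + 1) → ℝ := fun j => A.q j * A.bid j with hw
  have hw0 : ∀ j, 0 ≤ w j := fun j => mul_nonneg (A.q j).2.1 (hb j)
  set m := σ.symm i with hm
  have hσm : σ m = i := by simp [hm]
  set v : Fin (n + 1) → ℝ := fun j => if j = i then 0 else w j with hv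
  have hSW : ∀ θ' : Allocation (n + 1), A.socialWelfareWithout i θ' =
      ∑ j, A.Lam (θ'.symm j) * v j := by
    intro θ'
    unfold socialWelfareWithout
    rw [Finset.sum_filter]
    refine Finset.sum_congr rfl fun j _ => ?_
    by_cases h : j = i
    · simp [h, hv]
    · simp [h, hv, value, hw, mul_assoc]
  -- the permutation of the slots that moves slot `m` to the end
  let c : Equiv.Perm (Fin (n + 1)) := (finSuccEquiv' (Fin.last n)).trans (finSuccEquiv' m).symm
  have hc_last : c (Fin.last n) = m := by simp [c]
  have hc_cast : ∀ l : Fin n, c l.castSucc = m.succAbove l := by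
    intro l
    simp only [c, Equiv.trans_apply]
    rw [← Fin.succAbove_last_apply, finSuccEquiv'_succAbove, finSuccEquiv'_symm_some]
  let σ' : Allocation (n + 1) := c.trans σ
  have hv_last : v (σ' (Fin.last n)) = 0 := by simp [σ', hc_last, hσm, hv]
  have hv_cast : ∀ l : Fin n, v (σ' l.castSucc) = w (σ (m.succAbove l)) := by
    intro l
    have : σ (m.succAbove l) ≠ i := by
      rw [← hσm]; exact fun h => Fin.succAbove_ne m l (σ.injective h)
    simp [σ', hc_cast, hv, this]
  have hanti : Antitone fun l => v (σ' l) := by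
    intro l l' hll
    induction l' using Fin.lastCases with
    | last =>
      simp only [hv_last]
      simp only [hv]
      split_ifs
      · exact le_rfl
      · exact hw0 _
    | cast l' =>
      induction l using Fin.lastCases with
      | last => exact absurd hll (not_le.2 (Fin.castSucc_lt_last l'))
      | cast l =>
        simp only [hv_cast]
        exact hσ ((Fin.strictMono_succAbove m).monotone (by simpa using hll))
  have hmono : Monovary A.Lam fun l => v (σ' l) := A.Lam_antitone.monovary hanti
  have key : A.socialWelfareWithout i θ ≤ ∑ l, A.Lam l * v (σ' l) := by
    rw [hSW, ← Equiv.sum_comp σ']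
    exact hmono.sum_comp_perm_mul_le_sum_mul (σ := σ'.trans θ.symm)
  refine key.trans ?_
  rw [hSW σ, ← Equiv.sum_comp σ (fun j => A.Lam (σ.symm j) * v j), Fin.sum_univ_castSucc,
    Fin.sum_univ_succAbove _ m, hv_last, hσm, vcgTail, Finset.sum_filter,
    Fin.sum_univ_succAbove _ m]
  simp only [hv_cast]
  simp only [hv, if_true, mul_zero, add_zero, zero_add, lt_irrefl, if_false,
    Equiv.symm_apply_apply]
  rw [← Finset.sum_add_distrib]
  refine Finset.sum_le_sum fun l _ => ?_
  have hne : σ (m.succAbove l) ≠ i := by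
    rw [← hσm]; exact fun h => Fin.succAbove_ne m l (σ.injective h)
  rw [if_neg hne]
  simp only [Lam_eq_lamNat]
  rcases lt_or_ge l.castSucc m with h | h
  · rw [Fin.succAbove_of_castSucc_lt _ _ h, if_neg (not_lt.2 h.le)]
    simp
  · rw [Fin.succAbove_of_le_castSucc _ _ h, if_pos (lt_of_le_of_lt h (Fin.castSucc_lt_succ))]
    simp only [Fin.val_castSucc, Fin.val_succ, Nat.add_sub_cancel]
    apply le_of_eq
    simp only [hw]
    ring

/-- An upper bound on the Vickrey–Clarke–Groves revenue. The efficient allocation need not be a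
ranking, but only its social welfare matters for the total. -/
lemma sum_vcgPayment_le (A : Auction N K) (hb : ∀ i, 0 ≤ A.bid i) {σ : Allocation N}
    (hσ : Antitone fun l => (A.q (σ l) : ℝ) * A.bid (σ l)) {θ : Allocation N}
    (hθ : A.IsEfficient θ) :
    ∑ i, A.vcgPayment θ i ≤ ∑ m, A.vcgTail (fun l => A.q (σ l) * A.bid (σ l)) m := by
  have h1 : ∀ θ' : Allocation N, ∑ i, A.socialWelfareWithout i θ' =
      N * A.socialWelfare θ' - A.socialWelfare θ' := by
    intro θ'
    rw [eq_sub_iff_add_eq]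
    conv_lhs => rw [socialWelfare, ← Finset.sum_add_distrib]
    simp [socialWelfareWithout_add_value]
  have h2 : ∑ i, A.socialWelfareWithout i σ ≤ ∑ i, A.socialWelfareWithout i θ := by
    rcases Nat.eq_zero_or_pos N with rfl | hN
    · simp
    have hN' : (1 : ℝ) ≤ N := by exact_mod_cast hN
    rw [h1, h1]
    nlinarith [hθ σ]
  have h3 : ∀ i, (⨆ θ', A.socialWelfareWithout i θ') ≤ A.socialWelfareWithout i σ +
      A.vcgTail (fun l => A.q (σ l) * A.bid (σ l)) (σ.symm i) :=
    fun i => ciSup_le fun θ' => A.socialWelfareWithout_le hb hσ i θ'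
  have h4 := Finset.sum_le_sum fun i (_ : i ∈ Finset.univ) => h3 i
  rw [Finset.sum_add_distrib, Equiv.sum_comp σ.symm] at h4
  simp only [vcgPayment, Finset.sum_sub_distrib]
  linarith

lemma value_nonneg (A : Auction N K) (hb : ∀ i, 0 ≤ A.bid i) (θ : Allocation N) (i : Fin N) :
    0 ≤ A.value θ i :=
  mul_nonneg (mul_nonneg (A.Lam_nonneg _) (A.q i).2.1) (hb i)

/-- By individual rationality, no more than the social welfare is paid. -/
lemma sum_vcgPayment_le_mul (A : Auction N K) {vmax : ℝ} (hv : 0 ≤ vmax)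
    (hbid : ∀ i, A.bid i ∈ Set.Icc 0 vmax) {θ : Allocation N} (hθ : A.IsEfficient θ) :
    ∑ i, A.vcgPayment θ i ≤ vmax * K := by
  have hb : ∀ i, 0 ≤ A.bid i := fun i => (hbid i).1
  have h1 : ∀ i, A.vcgPayment θ i ≤ vmax * A.Lam (θ.symm i) := by
    intro i
    have : (⨆ θ', A.socialWelfareWithout i θ') ≤ A.socialWelfare θ := ciSup_le fun θ' => by
      have := A.socialWelfareWithout_add_value i θ'
      linarith [hθ θ', A.value_nonneg hb θ' i]
    have h2 := A.socialWelfareWithout_add_value i θ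
    have h3 : A.value θ i ≤ vmax * A.Lam (θ.symm i) := by
      rw [value, mul_assoc, mul_comm vmax]
      refine mul_le_mul_of_nonneg_left ?_ (A.Lam_nonneg _)
      exact (mul_le_of_le_one_left (hb i) (A.q i).2.2).trans (hbid i).2
    rw [vcgPayment]
    linarith
  refine (Finset.sum_le_sum fun i _ => h1 i).trans ?_
  rw [← Finset.mul_sum]
  exact mul_le_mul_of_nonneg_left (A.sum_Lam_symm_le θ) hv

end Auction

/-- The sorted sequence of scores is monotone in the scores. -/
lemma sorted_le_sorted {w w' : Fin N → ℝ} (h : w ≤ w') {σ σ' : Allocation N}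
    (hσ : Antitone fun l => w (σ l)) (hσ' : Antitone fun l => w' (σ' l)) (l : Fin N) :
    w (σ l) ≤ w' (σ' l) := by
  -- one of the first `l + 1` entries of `σ` is not among the first `l` entries of `σ'`
  obtain ⟨k, hk, hk'⟩ : ∃ k ≤ l, l ≤ σ'.symm (σ k) := by
    by_contra! hcon
    have hsub : (Finset.Iic l).image (fun k => σ'.symm (σ k)) ⊆ Finset.Iio l := by
      intro x hx
      obtain ⟨k, hk, rfl⟩ := Finset.mem_image.1 hx
      exact Finset.mem_Iio.2 (hcon k (Finset.mem_Iic.1 hk))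
    have := Finset.card_le_card hsub
    rw [Finset.card_image_of_injective _ fun a b h => σ.injective (σ'.symm.injective h),
      Fin.card_Iic, Fin.card_Iio] at this
    omega
  calc w (σ l) ≤ w (σ k) := hσ hk
    _ ≤ w' (σ k) := h _
    _ = w' (σ' (σ'.symm (σ k))) := by simp
    _ ≤ w' (σ' l) := hσ' hk'

/-! ### Rankings -/

namespace IsRankingRule

variable {f : (Fin N → ℝ) → (Fin N → ℝ) → Allocation N}

/-- An ad is ranked below every ad with a strictly higher score. -/
lemma card_le_slot (hf : IsRankingRule f) {e x : Fin N → ℝ} {i : Fin N} {S : Finset (Fin N)}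
    (hS : ∀ j ∈ S, e i * x i < e j * x j) : S.card ≤ ((f e x).symm i).val := by
  have hsub : S.image (f e x).symm ⊆ Finset.Iio ((f e x).symm i) := by
    intro y hy
    obtain ⟨j, hj, rfl⟩ := Finset.mem_image.1 hy
    refine Finset.mem_Iio.2 (lt_of_not_ge fun hle => ?_)
    have := hf.sorted e x hle
    simp only [Equiv.apply_symm_apply] at this
    exact absurd (hS j hj) (not_lt.2 this)
  have := Finset.card_le_card hsub
  rwa [Finset.card_image_of_injective _ (f e x).symm.injective, Fin.card_Iio] at this

/-- An ad with a higher report is not displayed lower, however ties are broken. -/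
lemma slot_update_le (hf : IsRankingRule f) {e : Fin N → ℝ} (x : Fin N → ℝ) {i : Fin N}
    (he : 0 < e i) {z z' : ℝ} (hz : z ≤ z') :
    (f e (Function.update x i z')).symm i ≤ (f e (Function.update x i z)).symm i := by
  rcases hz.eq_or_lt with rfl | hlt
  · exact le_rfl
  set x' := Function.update x i z' with hx'
  -- the ads above `i` at the higher value are strictly above it at the lower one
  have hc := hf.card_le_slot (e := e) (x := Function.update x i z) (i := i)
    (S := (Finset.Iio ((f e x').symm i)).image (f e x')) (by
      intro j hj
      obtain ⟨k, hk, rfl⟩ := Finset.mem_image.1 hj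
      rw [Finset.mem_Iio] at hk
      have hne : f e x' k ≠ i := fun h => by
        rw [← h, Equiv.symm_apply_apply] at hk
        exact lt_irrefl _ hk
      have h := hf.sorted e x' hk.le
      simp only [Equiv.apply_symm_apply] at h
      rw [Function.update_self, Function.update_of_ne hne]
      have h1 : x' i = z' := by simp [hx']
      have h2 : x' (f e x' k) = x (f e x' k) := Function.update_of_ne hne _ _
      rw [h1, h2] at h
      exact (mul_lt_mul_of_pos_left hlt he).trans_le h)
  rw [Finset.card_image_of_injective _ (f e x').injective, Fin.card_Iio] at hc
  exact hc

lemma measurable_comp (hf : IsRankingRule f) (g : Allocation N → ℝ) :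
    Measurable fun p : (Fin N → ℝ) × (Fin N → ℝ) => g (f p.1 p.2) := by
  have : (fun p : (Fin N → ℝ) × (Fin N → ℝ) => g (f p.1 p.2)) =
      fun p => ∑ θ, Set.indicator {p : (Fin N → ℝ) × (Fin N → ℝ) | f p.1 p.2 = θ}
        (fun _ => g θ) p := by
    ext p
    simp [Set.indicator_apply]
  rw [this]
  exact Finset.measurable_sum _ fun θ _ => measurable_const.indicator (hf.measurable θ)

end IsRankingRule

lemma sum_Ioc_pred_sub (g : ℕ → ℝ) {a b : ℕ} (h : a ≤ b) :
    ∑ k ∈ Finset.Ioc a b, (g (k - 1) - g k) = g a - g b := by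
  induction b, h using Nat.le_induction with
  | base => simp
  | succ b hab ih => rw [Finset.sum_Ioc_succ_top hab, ih]; simp

/-- When ad `i` lowers its report by a factor `u`, it falls below every ad `l` that was ranked
lower and whose score now exceeds its own. -/
lemma IsRankingRule.sum_le_Lam_sub {f : (Fin N → ℝ) → (Fin N → ℝ) → Allocation N}
    (hf : IsRankingRule f) (A : Auction N K) {e b : Fin N → ℝ} {i : Fin N} (he : 0 < e i)
    (hb : 0 ≤ b i) {u : ℝ} (hu : u ≤ 1) :
    ∑ l with (f e b).symm i < l, (A.lamNat (l.val - 1) - A.lamNat l) *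
        (if u * (e i * b i) < e (f e b l) * b (f e b l) then 1 else 0) ≤
      A.Lam ((f e b).symm i) - A.Lam ((f e (Function.update b i (u * b i))).symm i) := by
  set m := (f e b).symm i with hm
  set m' := (f e (Function.update b i (u * b i))).symm i with hm'
  have hfm : f e b m = i := by simp [hm]
  have hmm : m ≤ m' := by
    have := hf.slot_update_le b he (z := u * b i) (z' := b i) (mul_le_of_le_one_left hb hu)
    rwa [Function.update_eq_self] at this
  have hle : ∀ l, m < l → u * (e i * b i) < e (f e b l) * b (f e b l) → l ≤ m' := by
    intro l hml hl
    -- the other ads in the first `l + 1` slots all score higher than `u * (e i * b i)`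
    have hc := hf.card_le_slot (e := e) (x := Function.update b i (u * b i)) (i := i)
      (S := ((Finset.Iic l).erase m).image (f e b)) (by
        intro j hj
        obtain ⟨k, hk, rfl⟩ := Finset.mem_image.1 hj
        obtain ⟨hkm, hkl⟩ := Finset.mem_erase.1 hk
        have hne : f e b k ≠ i := by
          rw [← hfm]; exact fun h => hkm ((f e b).injective h)
        rw [Function.update_self, Function.update_of_ne hne]
        calc e i * (u * b i) = u * (e i * b i) := by ring
          _ < _ := hl
          _ ≤ _ := hf.sorted e b (Finset.mem_Iic.1 hkl))
    rw [Finset.card_image_of_injective _ (f e b).injective,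
      Finset.card_erase_of_mem (Finset.mem_Iic.2 hml.le), Fin.card_Iic] at hc
    exact Fin.le_def.2 (by simpa using hc)
  simp only [mul_ite, mul_one, mul_zero]
  rw [← Finset.sum_filter, Finset.filter_filter, Auction.Lam_eq_lamNat, Auction.Lam_eq_lamNat,
    ← sum_Ioc_pred_sub _ (Fin.le_def.1 hmm), ← Fin.map_valEmbedding_Ioc, Finset.sum_map]
  refine Finset.sum_le_sum_of_subset_of_nonneg ?_ fun l _ _ => A.lamNat_pred_sub_nonneg _
  intro l hl
  simp only [Finset.mem_filter, Finset.mem_univ, true_and] at hl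
  exact Finset.mem_Ioc.2 ⟨hl.1, hle l hl.1 hl.2⟩

/-! ### Self-resampling -/

instance (μ : unitInterval) : IsProbabilityMeasure (seedLaw μ) := by
  unfold seedLaw; infer_instance

/-- The factor by which the self-resampling procedure multiplies a report. -/
noncomputable def seedFactor (s : Seed) : ℝ := ∏ k ∈ Finset.range s.1, (s.2 k : ℝ)

lemma resampX_eq (b : ℝ) (s : Seed) : resampX b s = b * seedFactor s := rfl

lemma seedFactor_nonneg (s : Seed) : 0 ≤ seedFactor s :=
  Finset.prod_nonneg fun k _ => (s.2 k).2.1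

lemma measurable_seedFactor : Measurable seedFactor := by
  refine measurable_from_prod_countable_right fun n => ?_
  exact Finset.measurable_prod (Finset.range n) fun k _ =>
    (by fun_prop : Measurable fun v : ℕ → unitInterval => (v k : ℝ))

lemma measurable_resampX (b : ℝ) : Measurable (resampX b) :=
  measurable_const.mul measurable_seedFactor

lemma measurable_resampY (b : ℝ) : Measurable (resampY b) := by
  refine Measurable.ite ?_ measurable_const (by fun_prop)
  exact measurable_fst (measurableSet_singleton 0)

/-- A bounded measurable function is integrable against a probability measure. -/
lemma integrable_of_bounded {α : Type*} [MeasurableSpace α] {P : Measure α} [IsFiniteMeasure P]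
    {g : α → ℝ} (hg : Measurable g) (C : ℝ) (hC : ∀ x, |g x| ≤ C) : Integrable g P :=
  Integrable.of_bound hg.aestronglyMeasurable C (ae_of_all _ hC)

lemma hasSum_integral_seedLaw {μ : unitInterval} (hμ : μ < 1) {g : Seed → ℝ} (hg : Measurable g)
    (C : ℝ) (hC : ∀ x, |g x| ≤ C) :
    HasSum (fun n : ℕ => (μ : ℝ) ^ n * (1 - μ) *
        ∫ v, g (n, v) ∂(Measure.infinitePi fun _ : ℕ => (volume : Measure unitInterval)))
      (∫ s, g s ∂(seedLaw μ)) := by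
  have hint : Integrable g (seedLaw μ) := integrable_of_bounded hg C hC
  unfold seedLaw at hint ⊢
  have hp : unitInterval.symm μ ≠ 0 := by
    intro h
    have : μ = 1 := by simpa using h
    exact hμ.ne this
  rw [integral_prod _ hint]
  have := hasSum_integral_geometricMeasure hp hint.integral_prod_left
  simpa using this

/-- The product of `n + 1` uniform draws is the product of `n` draws and an independent one. -/
lemma integral_mul_volume (n : ℕ) {H : ℝ → ℝ} (hH : Measurable H) (C : ℝ) (hC : ∀ x, |H x| ≤ C) :
    ∫ v, H (∏ k ∈ Finset.range (n + 1), (v k : ℝ))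
        ∂(Measure.infinitePi fun _ : ℕ => (volume : Measure unitInterval)) =
      ∫ v, (∫ u : unitInterval, H (u * ∏ k ∈ Finset.range n, (v k : ℝ)))
        ∂(Measure.infinitePi fun _ : ℕ => (volume : Measure unitInterval)) := by
  set P := Measure.infinitePi fun _ : ℕ => (volume : Measure unitInterval) with hP
  have hind : iIndepFun (fun (k : ℕ) (v : ℕ → unitInterval) => (v k : unitInterval)) P :=
    iIndepFun_infinitePi (X := fun _ u => u) fun _ => measurable_id
  have hmp : Measurable (∏ j ∈ Finset.range n, fun v : ℕ → unitInterval => v j) := by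
    have : Measurable fun v : ℕ → unitInterval => ∏ j ∈ Finset.range n, v j :=
      Finset.measurable_prod _ fun k _ => measurable_pi_apply k
    convert this using 1
    ext v
    rw [Finset.prod_apply]
  have h1 := hind.indepFun_prod_range_succ (fun _ => measurable_pi_apply _) n
  have h2 := (indepFun_iff_map_prod_eq_prod_map_map
    hmp.aemeasurable
    (measurable_pi_apply n).aemeasurable).1 h1
  have h3 : P.map (fun v : ℕ → unitInterval => v n) = volume := by
    rw [hP]; exact Measure.infinitePi_map_eval _ n
  rw [h3] at h2
  have hm : Measurable fun p : unitInterval × unitInterval => H (p.2 * p.1 : ℝ) := by fun_prop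
  have hcoe : ∀ v : ℕ → unitInterval, (((∏ j ∈ Finset.range n,
      fun v : ℕ → unitInterval => v j) v : unitInterval) : ℝ) =
      ∏ k ∈ Finset.range n, (v k : ℝ) := by
    intro v
    rw [Finset.prod_apply]
    generalize Finset.range n = S
    induction S using Finset.induction_on with
    | empty => simp
    | insert a S ha ih => rw [Finset.prod_insert ha, Finset.prod_insert ha, ← ih, Set.Icc.coe_mul]
  have h4 : ∫ p, H (p.2 * p.1 : ℝ) ∂(P.map fun v : ℕ → unitInterval =>
      ((∏ j ∈ Finset.range n, fun v : ℕ → unitInterval => v j) v, v n)) =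
      ∫ v, H (∏ k ∈ Finset.range (n + 1), (v k : ℝ)) ∂P := by
    rw [integral_map (hmp.prodMk (measurable_pi_apply n)).aemeasurable hm.aestronglyMeasurable]
    refine integral_congr_ae (ae_of_all _ fun v => ?_)
    simp only [hcoe, Finset.prod_range_succ]
    rw [mul_comm]
  rw [← h4, h2, integral_prod _ (integrable_of_bounded hm C fun _ => hC _),
    integral_map hmp.aemeasurable]
  · simp only [hcoe]
  · exact (StronglyMeasurable.integral_prod_right hm.stronglyMeasurable).aestronglyMeasurable

/-- Conditionally on being resampled at least once, a report is replaced by the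
self-resampling of a uniform draw. -/
lemma integral_seedLaw_resampled {μ : unitInterval} (hμ : μ < 1) {H : ℝ → ℝ} (hH : Measurable H)
    (C : ℝ) (hC : ∀ x, |H x| ≤ C) :
    ∫ s : Seed, (if s.1 = 0 then 0 else H (seedFactor s)) ∂(seedLaw μ) =
      μ * ∫ s, (∫ u : unitInterval, H (u * seedFactor s)) ∂(seedLaw μ) := by
  have hC0 : 0 ≤ C := (abs_nonneg _).trans (hC 0)
  have hm1 : Measurable fun s : Seed => (if s.1 = 0 then 0 else H (seedFactor s) : ℝ) :=
    Measurable.ite (measurable_fst (measurableSet_singleton 0)) measurable_const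
      (hH.comp measurable_seedFactor)
  have hm2 : Measurable fun s : Seed => ∫ u : unitInterval, H (u * seedFactor s) := by
    have : Measurable fun p : Seed × unitInterval => H (p.2 * seedFactor p.1) :=
      hH.comp ((measurable_subtype_coe.comp measurable_snd).mul
        (measurable_seedFactor.comp measurable_fst))
    exact (StronglyMeasurable.integral_prod_right this.stronglyMeasurable).measurable
  have hs1 := hasSum_integral_seedLaw hμ hm1 C (fun s => by split_ifs <;> simp [hC0, hC])
  have hs2 := hasSum_integral_seedLaw hμ hm2 C (fun s => by
    have := norm_integral_le_of_norm_le_const (μ := (volume : Measure unitInterval))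
      (f := fun u => H (u * seedFactor s)) (C := C) (ae_of_all _ fun u => hC _)
    simpa using this)
  have hs3 := hs2.mul_left (μ : ℝ)
  have hs4 := (hasSum_nat_add_iff' 1).2 hs1
  simp only [Finset.sum_range_one, if_true, integral_zero, mul_zero, sub_zero] at hs4
  refine hs4.unique ?_
  refine Eq.mp (congrArg (HasSum · _) (funext fun n => ?_)) hs3
  simp only [Nat.add_eq_zero_iff, one_ne_zero, and_false, if_false, seedFactor, pow_succ]
  rw [integral_mul_volume n hH C hC]
  ring

/-! ### Expected payments in an exploitation round -/

instance (A : Auction N K) : IsProbabilityMeasure (userLaw A) := by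
  unfold userLaw; infer_instance

/-- The click indicator as a product over the independent components of the user. -/
lemma click_eq (θ : Allocation N) (i : Fin N) (u : User N K) :
    click θ i u = (if (θ.symm i).val < K then
      ∏ l : Fin K, (if l.val < (θ.symm i).val then (if u.1 l = true then 1 else 0) else 1) else 0) *
      (if u.2 i = true then 1 else 0) := by
  have h : (∏ l : Fin K, (if l.val < (θ.symm i).val then (if u.1 l = true then (1 : ℝ) else 0)
      else 1)) = if ∀ l : Fin K, l.val < (θ.symm i).val → u.1 l = true then 1 else 0 := by
    split_ifs with h
    · exact Finset.prod_eq_one fun l _ => by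
        split_ifs with h1 h2
        · rfl
        · exact absurd (h l h1) h2
        · rfl
    · push Not at h
      obtain ⟨l, hl, hl'⟩ := h
      exact Finset.prod_eq_zero (Finset.mem_univ l) (by simp [hl, hl'])
  rw [h]
  unfold click
  split_ifs <;> simp_all

lemma integral_click (A : Auction N K) (θ : Allocation N) (i : Fin N) :
    ∫ u, click θ i u ∂(userLaw A) = A.Lam (θ.symm i) * A.q i := by
  simp only [click_eq]
  unfold userLaw
  rw [integral_prod_mul
    (f := fun v : Fin K → Bool => if (θ.symm i).val < K then
      ∏ l : Fin K, (if l.val < (θ.symm i).val then (if v l = true then (1 : ℝ) else 0) else 1)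
      else 0)
    (g := fun v : Fin N → Bool => if v i = true then (1 : ℝ) else 0)]
  congr 1
  · unfold Auction.Lam
    split_ifs with h
    · rw [integral_fintype_prod_eq_prod (fun (l : Fin K) (c : Bool) =>
        if l.val < (θ.symm i).val then (if c = true then (1 : ℝ) else 0) else 1),
        Finset.prod_filter]
      refine Finset.prod_congr rfl fun l _ => ?_
      split_ifs with hl <;> simp [integral_bernoulliMeasure]
    · simp
  · refine (integral_comp_eval (X := fun _ : Fin N => Bool) (i := i)
      (μ := fun i => bernoulliMeasure true false (A.q i))
      (f := fun c : Bool => if c = true then (1 : ℝ) else 0)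
      (measurable_of_countable _).aestronglyMeasurable).trans ?_
    simp [integral_bernoulliMeasure]

/-- The payment of ad `i` in an exploitation round with estimates `e` and seeds `s`, in expectation
over the clicks. -/
noncomputable def netPayment (A : Auction N K)
    (f : (Fin N → ℝ) → (Fin N → ℝ) → Allocation N) (μ : unitInterval)
    (e : Fin N → ℝ) (s : Fin N → Seed) (i : Fin N) : ℝ :=
  A.Lam ((f e fun j => resampX (A.bid j) (s j)).symm i) * A.q i *
    (A.bid i - if resampY (A.bid i) (s i) < A.bid i then 1 / (μ : ℝ) * A.bid i else 0)

lemma integral_clickPayment (A : Auction N K) (f : (Fin N → ℝ) → (Fin N → ℝ) → Allocation N)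
    (μ : unitInterval) (e : Fin N → ℝ) (s : Fin N → Seed) (i : Fin N) :
    ∫ w, clickPayment A f μ e s i w ∂(userLaw A) = netPayment A f μ e s i := by
  unfold clickPayment netPayment
  rw [integral_mul_const, integral_click]

/-- Resampling one coordinate of a product measure does not change it. -/
lemma measurePreserving_update {β : Type*} [MeasurableSpace β] (P : Measure β)
    [IsProbabilityMeasure P] (i : Fin N) :
    MeasurePreserving (fun p : (Fin N → β) × β => Function.update p.1 i p.2)
      ((Measure.pi fun _ => P).prod P) (Measure.pi fun _ => P) := by
  have hm : Measurable fun p : (Fin N → β) × β => Function.update p.1 i p.2 :=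
    measurable_update'
  refine ⟨hm, (Measure.pi_eq fun t ht => ?_).symm⟩
  rw [Measure.map_apply hm (MeasurableSet.univ_pi ht)]
  have : (fun p : (Fin N → β) × β => Function.update p.1 i p.2) ⁻¹' Set.univ.pi t =
      (Set.univ.pi (Function.update t i Set.univ)) ×ˢ t i := by
    ext p
    simp only [Set.mem_preimage, Set.mem_univ_pi, Set.mem_prod]
    constructor
    · intro h
      refine ⟨fun j => ?_, by simpa using h i⟩
      by_cases hj : j = i
      · subst hj; simp
      · simpa [hj] using h j
    · rintro ⟨h1, h2⟩ j
      by_cases hj : j = i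
      · subst hj; simpa using h2
      · simpa [hj] using h1 j
  rw [this, Measure.prod_prod, Measure.pi_pi, ← Finset.mul_prod_erase _ _ (Finset.mem_univ i),
    ← Finset.mul_prod_erase _ (fun j => P (t j)) (Finset.mem_univ i)]
  simp only [Function.update_self, measure_univ, one_mul]
  rw [mul_comm]
  congr 1
  exact Finset.prod_congr rfl fun j hj => by rw [Function.update_of_ne (Finset.ne_of_mem_erase hj)]

lemma integral_pi_update {β : Type*} [MeasurableSpace β] (P : Measure β)
    [IsProbabilityMeasure P] (i : Fin N) {F : (Fin N → β) → ℝ} (hF : Measurable F) (C : ℝ)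
    (hC : ∀ x, |F x| ≤ C) :
    ∫ s, F s ∂(Measure.pi fun _ => P) =
      ∫ s, (∫ r, F (Function.update s i r) ∂P) ∂(Measure.pi fun _ => P) := by
  have h := measurePreserving_update P i
  rw [← h.map_eq, integral_map h.measurable.aemeasurable hF.aestronglyMeasurable, h.map_eq,
    integral_prod _ (integrable_of_bounded (g := fun p => F (Function.update p.1 i p.2))
      (hF.comp h.measurable) C fun _ => hC _)]

/-- The loss of observation probability that ad `i` suffers when it multiplies its value `x i` by
a uniform factor. Multiplied by `x i`, it is the payment that makes the ranking truthful. -/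
noncomputable def rankGain (A : Auction N K) (f : (Fin N → ℝ) → (Fin N → ℝ) → Allocation N)
    (e x : Fin N → ℝ) (i : Fin N) : ℝ :=
  A.Lam ((f e x).symm i) -
    ∫ u : unitInterval, A.Lam ((f e (Function.update x i (u * x i))).symm i)

variable {f : (Fin N → ℝ) → (Fin N → ℝ) → Allocation N}

lemma IsRankingRule.measurable_Lam (hf : IsRankingRule f) (A : Auction N K) (i : Fin N) :
    Measurable fun p : (Fin N → ℝ) × (Fin N → ℝ) => A.Lam ((f p.1 p.2).symm i) :=
  hf.measurable_comp fun θ => A.Lam (θ.symm i)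

lemma Auction.abs_Lam_le_one (A : Auction N K) (m : Fin N) : |A.Lam m| ≤ 1 := by
  rw [abs_of_nonneg (A.Lam_nonneg m)]; exact A.Lam_le_one m

lemma measurable_update_mul (i : Fin N) :
    Measurable fun p : (Fin N → ℝ) × unitInterval =>
      Function.update p.1 i (p.2 * p.1 i : ℝ) :=
  measurable_update'.comp (measurable_fst.prodMk (by fun_prop))

lemma IsRankingRule.measurable_Lam_update (hf : IsRankingRule f) (A : Auction N K)
    (e : Fin N → ℝ) (i : Fin N) :
    Measurable fun p : (Fin N → ℝ) × unitInterval =>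
      A.Lam ((f e (Function.update p.1 i (p.2 * p.1 i : ℝ))).symm i) :=
  (hf.measurable_Lam A i).comp (measurable_const.prodMk (measurable_update_mul i))

lemma IsRankingRule.measurable_integral_Lam_update (hf : IsRankingRule f) (A : Auction N K)
    (e : Fin N → ℝ) (i : Fin N) :
    Measurable fun x : Fin N → ℝ =>
      ∫ u : unitInterval, A.Lam ((f e (Function.update x i (u * x i))).symm i) :=
  (StronglyMeasurable.integral_prod_right
    (hf.measurable_Lam_update A e i).stronglyMeasurable).measurable

lemma abs_integral_Lam_update_le (A : Auction N K) (e x : Fin N → ℝ) (i : Fin N) :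
    |∫ u : unitInterval, A.Lam ((f e (Function.update x i (u * x i))).symm i)| ≤ 1 := by
  have := norm_integral_le_of_norm_le_const (μ := (volume : Measure unitInterval))
    (f := fun u => A.Lam ((f e (Function.update x i (u * x i))).symm i)) (C := 1)
    (ae_of_all _ fun u => A.abs_Lam_le_one _)
  simpa using this

lemma IsRankingRule.measurable_rankGain (hf : IsRankingRule f) (A : Auction N K)
    (e : Fin N → ℝ) (i : Fin N) : Measurable fun x => rankGain A f e x i :=
  ((hf.measurable_Lam A i).comp (measurable_const.prodMk measurable_id)).sub
    (hf.measurable_integral_Lam_update A e i)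

lemma IsRankingRule.integrable_Lam_update (hf : IsRankingRule f) (A : Auction N K)
    (e x : Fin N → ℝ) (i : Fin N) :
    Integrable fun u : unitInterval => A.Lam ((f e (Function.update x i (u * x i))).symm i) :=
  integrable_of_bounded ((hf.measurable_Lam_update A e i).comp
    (measurable_const.prodMk measurable_id)) 1 fun _ => A.abs_Lam_le_one _

lemma IsRankingRule.rankGain_nonneg (hf : IsRankingRule f) (A : Auction N K) {e x : Fin N → ℝ}
    {i : Fin N} (he : 0 < e i) (hx : 0 ≤ x i) : 0 ≤ rankGain A f e x i := by
  refine sub_nonneg.2 ?_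
  calc _ ≤ ∫ _ : unitInterval, A.Lam ((f e x).symm i) := by
        refine integral_mono (hf.integrable_Lam_update A e x i) (integrable_const _) fun u => ?_
        have := hf.slot_update_le x he (z := u * x i) (z' := x i)
          (mul_le_of_le_one_left hx u.2.2)
        rw [Function.update_eq_self] at this
        exact A.Lam_antitone this
    _ = _ := by simp

lemma rankGain_le (A : Auction N K) (e x : Fin N → ℝ) (i : Fin N) :
    rankGain A f e x i ≤ A.Lam ((f e x).symm i) :=
  sub_le_self _ (integral_nonneg fun _ => A.Lam_nonneg _)

lemma volume_real_mul_lt {w w' : ℝ} (hw' : 0 ≤ w') (h : w' ≤ w) :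
    w * (volume : Measure unitInterval).real {u | u * w < w'} = w' := by
  rcases (hw'.trans h).eq_or_lt with h0 | h0
  · have : w' = 0 := by linarith
    rw [← h0, this]; simp
  · have hset : {u : unitInterval | u * w < w'} =
        Set.Iio ⟨w' / w, div_nonneg hw' h0.le, (div_le_one h0).2 h⟩ := by
      ext u
      simp [← Subtype.coe_lt_coe, lt_div_iff₀ h0]
    rw [hset, measureReal_def, unitInterval.volume_Iio, ENNReal.toReal_ofReal
      (div_nonneg hw' h0.le)]
    field_simp

/-- The truthful payment of an ad in a ranking by `e i * b i`, scaled by its estimated quality, is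
at least the externality that it imposes according to the estimates. -/
lemma IsRankingRule.vcgTail_le_rankGain (hf : IsRankingRule f) (A : Auction N K)
    {e b : Fin N → ℝ} (he : ∀ i, 0 < e i) (hb : ∀ i, 0 ≤ b i) (i : Fin N) :
    A.vcgTail (fun l => e (f e b l) * b (f e b l)) ((f e b).symm i) ≤
      e i * b i * rankGain A f e b i := by
  set m := (f e b).symm i with hm
  have hw0 : ∀ j, 0 ≤ e j * b j := fun j => mul_nonneg (he j).le (hb j)
  set ind : Fin N → unitInterval → ℝ := fun l => Set.indicator
    {u : unitInterval | u * (e i * b i) < e (f e b l) * b (f e b l)} 1 with hind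
  have hmeas : ∀ l, MeasurableSet
      {u : unitInterval | u * (e i * b i) < e (f e b l) * b (f e b l)} := fun l =>
    measurableSet_lt (by fun_prop) measurable_const
  have hI : ∀ l, ∫ u, ind l u =
      (volume : Measure unitInterval).real
        {u | u * (e i * b i) < e (f e b l) * b (f e b l)} := fun l =>
    integral_indicator_one (hmeas l)
  have hint : ∀ l, Integrable (ind l) := fun l =>
    (integrable_const (1 : ℝ)).indicator (hmeas l)
  have h1 : ∫ u : unitInterval, ∑ l with m < l, (A.lamNat (l.val - 1) - A.lamNat l) * ind l u ≤
      rankGain A f e b i := by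
    have : rankGain A f e b i = ∫ u : unitInterval, (A.Lam m -
        A.Lam ((f e (Function.update b i (u * b i))).symm i)) := by
      rw [integral_sub (integrable_const _) (hf.integrable_Lam_update A e b i)]
      simp [rankGain, hm]
    rw [this]
    refine integral_mono (integrable_finsetSum _ fun l _ => (hint l).const_mul _)
      ((integrable_const _).sub (hf.integrable_Lam_update A e b i)) fun u => ?_
    have := hf.sum_le_Lam_sub A (he i) (hb i) u.2.2
    simpa [hind, Set.indicator_apply] using this
  rw [integral_finsetSum _ fun l _ => (hint l).const_mul _] at h1
  refine le_trans (le_of_eq ?_) (mul_le_mul_of_nonneg_left h1 (hw0 i))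
  rw [Finset.mul_sum, Auction.vcgTail]
  refine Finset.sum_congr rfl fun l hl => ?_
  have hl : m < l := by simpa using hl
  have hle : e (f e b l) * b (f e b l) ≤ e i * b i := by
    simpa [hm] using hf.sorted e b hl.le
  rw [integral_const_mul, hI, mul_left_comm (e i * b i), volume_real_mul_lt (hw0 _) hle]

/-- With optimistic estimates of accuracy `2 * η`, the truthful payments of the ranking by
estimates fall short of the Vickrey–Clarke–Groves revenue by at most `2 * η * vmax * K`. -/
lemma IsRankingRule.sum_vcgPayment_sub_le (hf : IsRankingRule f) (A : Auction N K) {vmax : ℝ}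
    (hv : 0 ≤ vmax) (hbid : ∀ i, A.bid i ∈ Set.Icc 0 vmax) {θ : Allocation N}
    (hθ : A.IsEfficient θ) {e : Fin N → ℝ} {η : ℝ} (he : ∀ i, 0 < e i) (hη : 0 ≤ η)
    (hqe : ∀ i, (A.q i : ℝ) ≤ e i) (heq : ∀ i, e i ≤ A.q i + 2 * η) :
    ∑ i, A.vcgPayment θ i - vmax * K * (2 * η) ≤
      ∑ i, A.q i * A.bid i * rankGain A f e A.bid i := by
  have hb : ∀ i, 0 ≤ A.bid i := fun i => (hbid i).1
  set σq := f (fun i => A.q i) A.bid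
  have h1 := A.sum_vcgPayment_le hb (hf.sorted (fun i => A.q i) A.bid) hθ
  have h2 : ∀ m, A.vcgTail (fun l => A.q (σq l) * A.bid (σq l)) m ≤
      A.vcgTail (fun l => e (f e A.bid l) * A.bid (f e A.bid l)) m :=
    A.vcgTail_mono fun l => sorted_le_sorted (w := fun j => A.q j * A.bid j)
      (w' := fun j => e j * A.bid j) (fun j => mul_le_mul_of_nonneg_right (hqe j) (hb j))
      (hf.sorted (fun i => A.q i) A.bid) (hf.sorted e A.bid) l
  have h3 : ∀ i, A.vcgTail (fun l => e (f e A.bid l) * A.bid (f e A.bid l))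
      ((f e A.bid).symm i) - 2 * η * vmax * A.Lam ((f e A.bid).symm i) ≤
      A.q i * A.bid i * rankGain A f e A.bid i := by
    intro i
    have h4 := hf.vcgTail_le_rankGain A he hb i
    have h5 : A.bid i * rankGain A f e A.bid i ≤ vmax * A.Lam ((f e A.bid).symm i) :=
      mul_le_mul (hbid i).2 (rankGain_le A e A.bid i) (hf.rankGain_nonneg A (he i) (hb i)) hv
    have h6 : 0 ≤ A.bid i * rankGain A f e A.bid i :=
      mul_nonneg (hb i) (hf.rankGain_nonneg A (he i) (hb i))
    nlinarith [heq i]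
  have h7 := Finset.sum_le_sum fun i (_ : i ∈ Finset.univ) => h3 i
  rw [Finset.sum_sub_distrib, Equiv.sum_comp (f e A.bid).symm
    (A.vcgTail fun l => e (f e A.bid l) * A.bid (f e A.bid l)), ← Finset.mul_sum] at h7
  have h8 := A.sum_Lam_symm_le (f e A.bid)
  have h9 := Finset.sum_le_sum fun m (_ : m ∈ Finset.univ) => h2 m
  have h10 : 2 * η * vmax * ∑ i, A.Lam ((f e A.bid).symm i) ≤ 2 * η * vmax * K :=
    mul_le_mul_of_nonneg_left h8 (by positivity)
  linarith

/-! ### The self-resampling payment identity -/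

/-- The values by which the ads are ranked in an exploitation round. -/
noncomputable def resampledBids (A : Auction N K) (s : Fin N → Seed) : Fin N → ℝ :=
  fun j => resampX (A.bid j) (s j)

lemma measurable_resampledBids (A : Auction N K) : Measurable (resampledBids A) :=
  measurable_pi_lambda _ fun j => (measurable_resampX _).comp (measurable_pi_apply j)

lemma resampledBids_nonneg (A : Auction N K) (hb : ∀ i, 0 ≤ A.bid i) (s : Fin N → Seed)
    (i : Fin N) : 0 ≤ resampledBids A s i :=
  mul_nonneg (hb i) (seedFactor_nonneg _)

lemma resampledBids_update (A : Auction N K) (s : Fin N → Seed) (i : Fin N) (r : Seed) :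
    resampledBids A (Function.update s i r) =
      Function.update (resampledBids A s) i (A.bid i * seedFactor r) := by
  ext j
  by_cases h : j = i
  · subst h; simp [resampledBids, resampX_eq]
  · simp [resampledBids, h]

lemma IsRankingRule.measurable_Lam_resampledBids (hf : IsRankingRule f) (A : Auction N K)
    (e : Fin N → ℝ) (i : Fin N) :
    Measurable fun s => A.Lam ((f e (resampledBids A s)).symm i) :=
  (hf.measurable_Lam A i).comp (measurable_const.prodMk (measurable_resampledBids A))

/-- A report that is resampled at least once is almost surely lowered. -/
lemma ae_resampY_lt_iff (μ : unitInterval) {b : ℝ} (hb : 0 < b) :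
    ∀ᵐ s ∂(seedLaw μ), resampY b s < b ↔ s.1 ≠ 0 := by
  have h1 : ∀ᵐ v ∂(Measure.infinitePi fun _ : ℕ => (volume : Measure unitInterval)),
      v 0 ≠ 1 := by
    have h : ∀ᵐ u : unitInterval, u ≠ 1 := by
      simp [ae_iff]
    rw [← Measure.infinitePi_map_eval (fun _ : ℕ => (volume : Measure unitInterval)) 0] at h
    exact ae_of_ae_map (measurable_pi_apply 0).aemeasurable h
  have h2 : ∀ᵐ s ∂(seedLaw μ), s.2 0 ≠ 1 := by
    unfold seedLaw
    exact Measure.quasiMeasurePreserving_snd.ae h1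
  filter_upwards [h2] with s hs
  unfold resampY
  by_cases h : s.1 = 0
  · simp [h]
  · have : (s.2 0 : ℝ) < 1 := by
      exact lt_of_le_of_ne (s.2 0).2.2 fun h => hs (Subtype.ext h)
    simp only [h, if_false, ne_eq, not_false_iff, iff_true]
    exact mul_lt_of_lt_one_right hb this

/-- The law of the seeds of a round. -/
noncomputable abbrev seedsLaw (N : ℕ) (μ : unitInterval) : Measure (Fin N → Seed) :=
  Measure.pi fun _ => seedLaw μ

/-- The single-seed identity `integral_seedLaw_resampled` for one of the ads of a ranking. -/
lemma IsRankingRule.integral_Lam_resampled (hf : IsRankingRule f) (A : Auction N K)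
    {μ : unitInterval} (hμ1 : μ < 1) (e : Fin N → ℝ) (i : Fin N) :
    ∫ s, (if (s i).1 = 0 then 0 else A.Lam ((f e (resampledBids A s)).symm i)) ∂(seedsLaw N μ) =
      μ * ∫ s, (∫ u : unitInterval, A.Lam ((f e (Function.update (resampledBids A s) i
        (u * resampledBids A s i))).symm i)) ∂(seedsLaw N μ) := by
  have hm0 : MeasurableSet {s : Fin N → Seed | (s i).1 = 0} :=
    (measurable_fst.comp (measurable_pi_apply i)) (measurableSet_singleton 0)
  have hm1 : Measurable fun s : Fin N → Seed =>
      if (s i).1 = 0 then 0 else A.Lam ((f e (resampledBids A s)).symm i) :=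
    Measurable.ite hm0 measurable_const (hf.measurable_Lam_resampledBids A e i)
  have hm2 : Measurable fun s : Fin N → Seed => ∫ u : unitInterval,
      A.Lam ((f e (Function.update (resampledBids A s) i (u * resampledBids A s i))).symm i) :=
    (hf.measurable_integral_Lam_update A e i).comp (measurable_resampledBids A)
  rw [integral_pi_update (seedLaw μ) i hm1 1
      (fun s => by split_ifs <;> simp [A.abs_Lam_le_one]),
    integral_pi_update (seedLaw μ) i hm2 1
      (fun s => abs_integral_Lam_update_le A e _ i), ← integral_const_mul]
  refine integral_congr_ae (ae_of_all _ fun s => ?_)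
  -- for given reports of the other ads, this is the identity for a single seed
  have hH : Measurable fun z : ℝ =>
      A.Lam ((f e (Function.update (resampledBids A s) i (A.bid i * z))).symm i) :=
    (hf.measurable_Lam A i).comp (measurable_const.prodMk
      ((measurable_update _).comp (measurable_const.mul measurable_id)))
  have := integral_seedLaw_resampled hμ1 hH 1 fun _ => A.abs_Lam_le_one _
  simp only [Function.update_self, resampledBids_update, Function.update_idem]
  rw [this]
  simp only [mul_left_comm]

/-- The self-resampling payments are in expectation the truthful payments of the randomized
ranking. -/
lemma IsRankingRule.integral_netPayment (hf : IsRankingRule f) (A : Auction N K)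
    (hb : ∀ i, 0 ≤ A.bid i) {μ : unitInterval} (hμ0 : 0 < μ) (hμ1 : μ < 1) (e : Fin N → ℝ)
    (i : Fin N) :
    ∫ s, netPayment A f μ e s i ∂(seedsLaw N μ) =
      A.q i * A.bid i * ∫ s, rankGain A f e (resampledBids A s) i ∂(seedsLaw N μ) := by
  rcases (hb i).eq_or_lt with h0 | h0
  · simp [netPayment, ← h0]
  have hμ : (0 : ℝ) < μ := hμ0
  set α : (Fin N → Seed) → ℝ := fun s => A.Lam ((f e (resampledBids A s)).symm i) with hα
  have hαm : Measurable α := hf.measurable_Lam_resampledBids A e i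
  have hm0 : MeasurableSet {s : Fin N → Seed | (s i).1 = 0} :=
    (measurable_fst.comp (measurable_pi_apply i)) (measurableSet_singleton 0)
  have hae : ∀ᵐ s ∂(seedsLaw N μ), netPayment A f μ e s i =
      A.q i * A.bid i * α s -
        A.q i * A.bid i * (1 / μ) * (if (s i).1 = 0 then 0 else α s) := by
    have := (measurePreserving_eval (fun _ : Fin N => seedLaw μ) i).quasiMeasurePreserving.ae
      (ae_resampY_lt_iff μ h0)
    filter_upwards [this] with s hs
    have hs' : resampY (A.bid i) (s i) < A.bid i ↔ (s i).1 ≠ 0 := hs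
    have hα' : A.Lam ((f e fun j => resampX (A.bid j) (s j)).symm i) = α s := rfl
    simp only [netPayment, hα', hs', ne_eq, ite_not]
    split_ifs <;> ring
  rw [integral_congr_ae hae, integral_sub, integral_const_mul, integral_const_mul,
    hf.integral_Lam_resampled A hμ1]
  · have hg : ∫ s, rankGain A f e (resampledBids A s) i ∂(seedsLaw N μ) =
        ∫ s, α s ∂(seedsLaw N μ) - ∫ s, (∫ u : unitInterval,
          A.Lam ((f e (Function.update (resampledBids A s) i
            (u * resampledBids A s i))).symm i)) ∂(seedsLaw N μ) := by
      unfold rankGain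
      rw [integral_sub]
      · exact integrable_of_bounded hαm 1 fun _ => A.abs_Lam_le_one _
      · exact integrable_of_bounded ((hf.measurable_integral_Lam_update A e i).comp
          (measurable_resampledBids A)) 1 fun s => abs_integral_Lam_update_le A e _ i
    rw [hg]
    field_simp
  · exact (integrable_of_bounded hαm 1 fun _ => A.abs_Lam_le_one _).const_mul _
  · refine (integrable_of_bounded (Measurable.ite hm0 measurable_const hαm) 1 fun s => ?_).const_mul
      _
    split_ifs
    · simp
    · exact A.abs_Lam_le_one _

lemma seedLaw_real_zero {μ : unitInterval} (hμ : μ < 1) :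
    (seedLaw μ).real {s | s.1 = 0} = 1 - μ := by
  have hp : unitInterval.symm μ ≠ 0 := by
    intro h
    have : μ = 1 := by simpa using h
    exact hμ.ne this
  have : {s : Seed | s.1 = 0} = {0} ×ˢ Set.univ := by ext; simp
  rw [this, seedLaw, measureReal_prod_prod, geometricMeasure_real_singleton hp]
  simp

/-- With probability `(1 - μ) ^ N` no report is resampled, and otherwise the payment is nonnegative
because the ranking is monotone. -/
lemma IsRankingRule.le_integral_rankGain (hf : IsRankingRule f) (A : Auction N K)
    (hb : ∀ i, 0 ≤ A.bid i) {μ : unitInterval} (hμ1 : μ < 1) {e : Fin N → ℝ}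
    {i : Fin N} (he : 0 < e i) :
    (1 - μ : ℝ) ^ N * rankGain A f e A.bid i ≤
      ∫ s, rankGain A f e (resampledBids A s) i ∂(seedsLaw N μ) := by
  set S : Set (Fin N → Seed) := Set.univ.pi fun _ => {s : Seed | s.1 = 0} with hS
  have hSm : MeasurableSet S :=
    MeasurableSet.univ_pi fun _ => measurable_fst (measurableSet_singleton 0)
  have hSr : (seedsLaw N μ).real S = (1 - μ : ℝ) ^ N := by
    rw [hS, measureReal_def, Measure.pi_pi, ENNReal.toReal_prod]
    simp_rw [← measureReal_def, seedLaw_real_zero hμ1]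
    simp
  have h1 : ∫ s, S.indicator (fun _ => rankGain A f e A.bid i) s ∂(seedsLaw N μ) =
      (1 - μ : ℝ) ^ N * rankGain A f e A.bid i := by
    rw [integral_indicator_const _ hSm, hSr, smul_eq_mul]
  rw [← h1]
  refine integral_mono_of_nonneg (ae_of_all _ fun s => ?_) ?_ (ae_of_all _ fun s => ?_)
  · exact Set.indicator_nonneg (fun _ _ => hf.rankGain_nonneg A he (hb i)) s
  · refine integrable_of_bounded ((hf.measurable_rankGain A e i).comp
      (measurable_resampledBids A)) 1 fun s => ?_
    have h2 := hf.rankGain_nonneg A he (resampledBids_nonneg A hb s i)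
    refine (abs_of_nonneg h2).trans_le ?_
    exact (rankGain_le A _ _ _).trans (A.Lam_le_one _)
  · by_cases hs : s ∈ S
    · have : resampledBids A s = A.bid := by
        ext j
        have hj : (s j).1 = 0 := hs j (Set.mem_univ j)
        simp [resampledBids, resampX, hj]
      simp [hs, this]
    · simp only [hs, not_false_iff, Set.indicator_of_notMem]
      exact hf.rankGain_nonneg A he (resampledBids_nonneg A hb s i)

/-- The expected revenue of an exploitation round with estimates `e`. -/
noncomputable def roundRevenue (A : Auction N K)
    (f : (Fin N → ℝ) → (Fin N → ℝ) → Allocation N) (μ : unitInterval) (e : Fin N → ℝ) : ℝ :=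
  ∫ s, ∑ i, netPayment A f μ e s i ∂(seedsLaw N μ)

lemma abs_netPayment_le (A : Auction N K) {vmax : ℝ} (hv : 0 ≤ vmax)
    (hbid : ∀ i, A.bid i ∈ Set.Icc 0 vmax) (μ : unitInterval) (e : Fin N → ℝ)
    (s : Fin N → Seed) (i : Fin N) : |netPayment A f μ e s i| ≤ vmax + 1 / μ * vmax := by
  have hμ := μ.2.1
  unfold netPayment
  rw [abs_mul]
  have h1 : |A.Lam ((f e fun j => resampX (A.bid j) (s j)).symm i) * (A.q i : ℝ)| ≤ 1 := by
    rw [abs_mul, abs_of_nonneg (A.q i).2.1]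
    exact mul_le_one₀ (A.abs_Lam_le_one _) (A.q i).2.1 (A.q i).2.2
  have h3 : 1 / (μ : ℝ) * A.bid i ≤ 1 / μ * vmax :=
    mul_le_mul_of_nonneg_left (hbid i).2 (by positivity)
  have h4 : 0 ≤ 1 / (μ : ℝ) * A.bid i := mul_nonneg (by positivity) (hbid i).1
  have h2 : |A.bid i - if resampY (A.bid i) (s i) < A.bid i then 1 / (μ : ℝ) * A.bid i else 0| ≤
      vmax + 1 / μ * vmax := by
    have := (hbid i).1
    have := (hbid i).2
    rw [abs_le]
    split_ifs <;> constructor <;> linarith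
  calc _ ≤ 1 * (vmax + 1 / μ * vmax) := by gcongr
    _ = _ := one_mul _

lemma IsRankingRule.measurable_netPayment (hf : IsRankingRule f) (A : Auction N K)
    (μ : unitInterval) (i : Fin N) :
    Measurable fun p : (Fin N → ℝ) × (Fin N → Seed) => netPayment A f μ p.1 p.2 i := by
  unfold netPayment
  have h1 : Measurable fun p : (Fin N → ℝ) × (Fin N → Seed) =>
      A.Lam ((f p.1 (resampledBids A p.2)).symm i) :=
    (hf.measurable_Lam A i).comp
      (measurable_fst.prodMk ((measurable_resampledBids A).comp measurable_snd))
  refine (h1.mul_const _).mul (measurable_const.sub (Measurable.ite ?_ measurable_const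
    measurable_const))
  exact measurableSet_lt ((measurable_resampY _).comp
    ((measurable_pi_apply i).comp measurable_snd)) measurable_const

lemma IsRankingRule.roundRevenue_eq (hf : IsRankingRule f) (A : Auction N K) {vmax : ℝ}
    (hv : 0 ≤ vmax) (hbid : ∀ i, A.bid i ∈ Set.Icc 0 vmax) {μ : unitInterval}
    (hμ0 : 0 < μ) (hμ1 : μ < 1) (e : Fin N → ℝ) :
    roundRevenue A f μ e = ∑ i, A.q i * A.bid i *
      ∫ s, rankGain A f e (resampledBids A s) i ∂(seedsLaw N μ) := by
  unfold roundRevenue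
  rw [integral_finsetSum]
  · exact Finset.sum_congr rfl fun i _ =>
      hf.integral_netPayment A (fun i => (hbid i).1) hμ0 hμ1 e i
  · intro i _
    exact integrable_of_bounded ((hf.measurable_netPayment A μ i).comp
      (measurable_const.prodMk measurable_id)) _ fun s => abs_netPayment_le A hv hbid μ e s i

lemma IsRankingRule.roundRevenue_nonneg (hf : IsRankingRule f) (A : Auction N K) {vmax : ℝ}
    (hv : 0 ≤ vmax) (hbid : ∀ i, A.bid i ∈ Set.Icc 0 vmax) {μ : unitInterval}
    (hμ0 : 0 < μ) (hμ1 : μ < 1) {e : Fin N → ℝ} (he : ∀ i, 0 < e i) :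
    0 ≤ roundRevenue A f μ e := by
  rw [hf.roundRevenue_eq A hv hbid hμ0 hμ1]
  refine Finset.sum_nonneg fun i _ => mul_nonneg (mul_nonneg (A.q i).2.1 (hbid i).1) ?_
  exact integral_nonneg fun s =>
    hf.rankGain_nonneg A (he i) (resampledBids_nonneg A (fun i => (hbid i).1) s i)

/-- With accurate estimates, an exploitation round loses at most `vmax * K * (2 * η + μ * N)`. -/
lemma IsRankingRule.le_roundRevenue (hf : IsRankingRule f) (A : Auction N K) {vmax : ℝ}
    (hv : 0 ≤ vmax) (hbid : ∀ i, A.bid i ∈ Set.Icc 0 vmax) {θ : Allocation N}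
    (hθ : A.IsEfficient θ) {μ : unitInterval} (hμ0 : 0 < μ) (hμ1 : μ < 1) {e : Fin N → ℝ} {η : ℝ}
    (he : ∀ i, 0 < e i) (hη : 0 ≤ η)
    (hqe : ∀ i, (A.q i : ℝ) ≤ e i) (heq : ∀ i, e i ≤ A.q i + 2 * η) :
    ∑ i, A.vcgPayment θ i - vmax * K * (2 * η + μ * N) ≤ roundRevenue A f μ e := by
  have hb : ∀ i, 0 ≤ A.bid i := fun i => (hbid i).1
  set P := ∑ i, A.q i * A.bid i * rankGain A f e A.bid i with hP
  have hP0 : 0 ≤ P := Finset.sum_nonneg fun i _ =>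
    mul_nonneg (mul_nonneg (A.q i).2.1 (hb i)) (hf.rankGain_nonneg A (he i) (hb i))
  have hP1 : P ≤ vmax * K := by
    calc P ≤ ∑ i, vmax * A.Lam ((f e A.bid).symm i) := by
          refine Finset.sum_le_sum fun i _ => ?_
          refine mul_le_mul ?_ (rankGain_le A e A.bid i) (hf.rankGain_nonneg A (he i) (hb i)) hv
          exact (mul_le_of_le_one_left (hb i) (A.q i).2.2).trans (hbid i).2
      _ = vmax * ∑ i, A.Lam ((f e A.bid).symm i) := by rw [Finset.mul_sum]
      _ ≤ vmax * K := mul_le_mul_of_nonneg_left (A.sum_Lam_symm_le _) hv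
  have h1 : (1 - μ : ℝ) ^ N * P ≤ roundRevenue A f μ e := by
    rw [hf.roundRevenue_eq A hv hbid hμ0 hμ1, hP, Finset.mul_sum]
    refine Finset.sum_le_sum fun i _ => ?_
    rw [mul_left_comm]
    exact mul_le_mul_of_nonneg_left (hf.le_integral_rankGain A hb hμ1 (he i))
      (mul_nonneg (A.q i).2.1 (hb i))
  have h2 : 1 - (μ : ℝ) * N ≤ (1 - μ : ℝ) ^ N := by
    have := one_add_mul_le_pow (a := -(μ : ℝ)) (by linarith [μ.2.2]) N
    calc (1 - μ * N : ℝ) = 1 + N * -μ := by ring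
      _ ≤ _ := this
      _ = _ := by ring
  have h3 := hf.sum_vcgPayment_sub_le A hv hbid hθ he hη hqe heq
  have h4 : (1 - (μ : ℝ) * N) * P ≤ (1 - μ : ℝ) ^ N * P := mul_le_mul_of_nonneg_right h2 hP0
  have h5 : (μ * N : ℝ) * P ≤ μ * N * (vmax * K) :=
    mul_le_mul_of_nonneg_left hP1 (mul_nonneg μ.2.1 (Nat.cast_nonneg _))
  nlinarith

/-! ### Estimation of the qualities -/

lemma val_finRotate_pow (k : ℕ) (j : Fin N) : ((finRotate N ^ k) j).val = (j.val + k) % N := by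
  obtain _ | n := N
  · exact j.elim0
  induction k with
  | zero => simp [Nat.mod_eq_of_lt j.2]
  | succ k ih =>
    rw [pow_succ', Equiv.Perm.mul_apply, finRotate_apply, Fin.val_add, ih]
    simp [Nat.add_assoc]

lemma mem_firstSlotRounds {T τ : ℕ} {i : Fin N} {t : Fin T} :
    t ∈ firstSlotRounds τ i ↔ t.val < τ ∧ (t.val + 1) % N = i.val := by
  have hN : 0 < N := i.pos
  unfold firstSlotRounds exploreAlloc
  rw [Finset.mem_filter_univ]
  refine and_congr_right fun _ => ?_
  rw [← Nat.zero_add (t.val + 1), ← val_finRotate_pow (t.val + 1) (⟨0, hN⟩ : Fin N), ← Fin.ext_iff,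
    ← Equiv.eq_symm_apply, Fin.ext_iff, eq_comm, Nat.zero_add]

lemma le_card_firstSlotRounds {T τ : ℕ} (hτT : τ ≤ T) (i : Fin N) :
    τ / N ≤ (firstSlotRounds τ i : Finset (Fin T)).card := by
  have hN : 0 < N := i.pos
  set r := (i.val + (N - 1)) % N with hr
  have hrN : r < N := Nat.mod_lt _ hN
  have hlt : ∀ k < τ / N, k * N + r < τ := by
    intro k hk
    calc k * N + r < (k + 1) * N := by rw [Nat.succ_mul]; omega
      _ ≤ τ / N * N := Nat.mul_le_mul_right _ hk
      _ ≤ τ := Nat.div_mul_le_self _ _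
  have hsub : (Finset.range (τ / N)).image (fun k => k * N + r) ⊆
      (firstSlotRounds τ i : Finset (Fin T)).image Fin.val := by
    intro t ht
    obtain ⟨k, hk, rfl⟩ := Finset.mem_image.1 ht
    have hk' := hlt k (Finset.mem_range.1 hk)
    refine Finset.mem_image.2 ⟨⟨k * N + r, hk'.trans_le hτT⟩,
      mem_firstSlotRounds.2 ⟨hk', ?_⟩, rfl⟩
    have h1 : i.val + (N - 1) + 1 = i.val + N := by omega
    rw [Nat.add_assoc, Nat.mul_add_mod_self_right, hr, Nat.mod_add_mod, h1, Nat.add_mod_right,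
      Nat.mod_eq_of_lt i.2]
  have hinj : Function.Injective fun k : ℕ => k * N + r := fun a b hab =>
    Nat.eq_of_mul_eq_mul_right hN (Nat.add_right_cancel hab)
  have := Finset.card_le_card hsub
  rwa [Finset.card_image_of_injective _ hinj, Finset.card_image_of_injective _ Fin.val_injective,
    Finset.card_range] at this

lemma click_exploreAlloc (hK : 1 ≤ K) {T τ : ℕ} {i : Fin N} {t : Fin T}
    (ht : t ∈ firstSlotRounds τ i) (u : User N K) :
    click (exploreAlloc N t) i u = if u.2 i = true then 1 else 0 := by
  have h0 : ((exploreAlloc N t).symm i).val = 0 := by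
    simp only [firstSlotRounds, Finset.mem_filter] at ht
    exact ht.2.2
  simp only [click, h0]
  simp [Nat.lt_of_lt_of_le Nat.zero_lt_one hK]

instance (A : Auction N K) (μ : unitInterval) (T : ℕ) : IsProbabilityMeasure (runLaw A μ T) := by
  unfold runLaw; infer_instance

/-- Whether the user of a round clicks on ad `i` once it is observed. -/
noncomputable def wouldClick (i : Fin N) (r : User N K × (Fin N → Seed)) : ℝ :=
  if r.1.2 i = true then 1 else 0

lemma measurable_wouldClick (i : Fin N) : Measurable (wouldClick (K := K) i) := by
  have : Measurable fun c : Bool => if c = true then (1 : ℝ) else 0 := measurable_of_countable _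
  exact this.comp ((measurable_pi_apply i).comp (measurable_snd.comp measurable_fst))

lemma wouldClick_mem_Icc (i : Fin N) (r : User N K × (Fin N → Seed)) :
    wouldClick i r ∈ Set.Icc (0 : ℝ) 1 := by
  unfold wouldClick; split_ifs <;> simp

lemma integral_wouldClick (A : Auction N K) (μ : unitInterval) (i : Fin N) :
    ∫ r, wouldClick i r ∂((userLaw A).prod (seedsLaw N μ)) = A.q i := by
  have h1 : ∫ r, wouldClick i r ∂((userLaw A).prod (seedsLaw N μ)) =
      ∫ u : User N K, (if u.2 i = true then (1 : ℝ) else 0) ∂(userLaw A) := by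
    unfold wouldClick
    refine (integral_fun_fst (fun u : User N K => if u.2 i = true then (1 : ℝ) else 0)).trans ?_
    simp
  rw [h1, userLaw]
  refine (integral_fun_snd (fun v : Fin N → Bool => if v i = true then (1 : ℝ) else 0)).trans ?_
  simp only [probReal_univ, one_smul]
  refine (integral_comp_eval (X := fun _ : Fin N => Bool) (i := i)
    (μ := fun i => bernoulliMeasure true false (A.q i))
    (f := fun c : Bool => if c = true then (1 : ℝ) else 0)
    (measurable_of_countable _).aestronglyMeasurable).trans ?_
  simp [integral_bernoulliMeasure]

lemma qualityEstimate_eq (hK : 1 ≤ K) {T : ℕ} (τ : ℕ) (i : Fin N) (ω : Run N K T) :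
    qualityEstimate τ (fun r => (ω r).1) i = (∑ t ∈ firstSlotRounds τ i, wouldClick i (ω t)) /
      ((firstSlotRounds τ i : Finset (Fin T)).card : ℝ) := by
  unfold qualityEstimate
  congr 1
  exact Finset.sum_congr rfl fun t ht => click_exploreAlloc hK ht _

lemma qualityEstimate_mem_Icc (hK : 1 ≤ K) {T : ℕ} (τ : ℕ) (i : Fin N) (ω : Run N K T) :
    qualityEstimate τ (fun r => (ω r).1) i ∈ Set.Icc (0 : ℝ) 1 := by
  rw [qualityEstimate_eq hK]
  constructor
  · exact div_nonneg (Finset.sum_nonneg fun t _ => (wouldClick_mem_Icc i _).1) (Nat.cast_nonneg _)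
  · refine div_le_one_of_le₀ ?_ (Nat.cast_nonneg _)
    calc _ ≤ ∑ t ∈ (firstSlotRounds τ i : Finset (Fin T)), (1 : ℝ) :=
          Finset.sum_le_sum fun t _ => (wouldClick_mem_Icc i _).2
      _ = _ := by simp

/-- Hoeffding's inequality for both tails of the empirical quality. -/
lemma measure_qualityEstimate_le (A : Auction N K) (hK : 1 ≤ K) (μ : unitInterval) {T : ℕ} (τ : ℕ)
    (i : Fin N) {η : ℝ} (hη : 0 ≤ η) {n : ℕ}
    (hn : (firstSlotRounds τ i : Finset (Fin T)).card = n) (hn0 : 0 < n) :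
    (runLaw A μ T).real
      {ω | η < |qualityEstimate τ (fun r => (ω r).1) i - A.q i|} ≤
      2 * Real.exp (-(2 * n * η ^ 2)) := by
  set P := (userLaw A).prod (seedsLaw N μ) with hP
  set S : Finset (Fin T) := firstSlotRounds τ i with hS
  have hn' : (0 : ℝ) < n := by exact_mod_cast hn0
  have hm := measurable_wouldClick (K := K) i
  have hind : iIndepFun (fun (t : Fin T) (ω : Run N K T) => wouldClick i (ω t) - (A.q i : ℝ))
      (runLaw A μ T) :=
    iIndepFun_pi (X := fun _ r => wouldClick i r - (A.q i : ℝ))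
      fun _ => (hm.sub_const _).aemeasurable
  have hsub : ∀ t : Fin T, HasSubgaussianMGF
      (fun ω : Run N K T => wouldClick i (ω t) - (A.q i : ℝ)) ((‖(1 : ℝ) - 0‖₊ / 2) ^ 2)
      (runLaw A μ T) := by
    intro t
    have h1 := hasSubgaussianMGF_of_mem_Icc (μ := P) hm.aemeasurable
      (ae_of_all _ fun r => wouldClick_mem_Icc i r)
    rw [integral_wouldClick] at h1
    have h2 : (runLaw A μ T).map (fun ω => ω t) = P :=
      (measurePreserving_eval (fun _ : Fin T => P) t).map_eq
    rw [← h2] at h1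
    exact HasSubgaussianMGF.of_map (Y := fun ω : Run N K T => ω t)
      (measurable_pi_apply t).aemeasurable h1
  have hexp : -(n * η) ^ 2 / (2 * ∑ t ∈ S, (((‖(1 : ℝ) - 0‖₊ / 2) ^ 2 : NNReal) : ℝ)) =
      -(2 * n * η ^ 2) := by
    rw [Finset.sum_const, hn]
    simp only [sub_zero, nnnorm_one, NNReal.coe_pow, NNReal.coe_div, NNReal.coe_one,
      NNReal.coe_ofNat, nsmul_eq_mul]
    field_simp
  have hε : 0 ≤ n * η := by positivity
  have hup := HasSubgaussianMGF.measure_sum_ge_le_of_iIndepFun hind (s := S)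
    (fun t _ => hsub t) hε
  have hlo := HasSubgaussianMGF.measure_sum_ge_le_of_iIndepFun
    (X := fun (t : Fin T) (ω : Run N K T) => -(wouldClick i (ω t) - (A.q i : ℝ)))
    (hind.comp (fun _ x => -x) fun _ => measurable_neg) (s := S)
    (fun t _ => (hsub t).neg) hε
  push_cast at hup hlo hexp
  rw [hexp] at hup hlo
  have hsubset : {ω : Run N K T | η < |qualityEstimate τ (fun r => (ω r).1) i - A.q i|} ⊆
      {ω | n * η ≤ ∑ t ∈ S, (wouldClick i (ω t) - (A.q i : ℝ))} ∪
      {ω | n * η ≤ ∑ t ∈ S, -(wouldClick i (ω t) - (A.q i : ℝ))} := by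
    intro ω hω
    simp only [Set.mem_ofPred_eq, qualityEstimate_eq hK, ← hS, hn] at hω
    have hsum : ∑ t ∈ S, (wouldClick i (ω t) - (A.q i : ℝ)) =
        n * ((∑ t ∈ S, wouldClick i (ω t)) / n - A.q i) := by
      rw [Finset.sum_sub_distrib, Finset.sum_const, hn, nsmul_eq_mul]
      field_simp
    simp only [Set.mem_union, Set.mem_ofPred_eq, Finset.sum_neg_distrib, hsum]
    rcases lt_abs.1 hω with h | h
    · left; exact mul_le_mul_of_nonneg_left h.le hn'.le
    · right
      rw [← mul_neg]
      exact mul_le_mul_of_nonneg_left h.le hn'.le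
  calc _ ≤ _ := measureReal_mono hsubset
    _ ≤ _ := measureReal_union_le _ _
    _ ≤ _ := by linarith

lemma one_lt_log_ratio {δ : ℝ} (hN : 2 ≤ N) (hδ0 : 0 < δ) (hδ1 : δ ≤ 1) :
    1 < Real.log (2 * N / δ) := by
  have h4 : (4 : ℝ) ≤ 2 * N / δ := by
    have : (2 : ℝ) ≤ N := by exact_mod_cast hN
    rw [le_div_iff₀ hδ0]
    linarith
  rw [Real.lt_log_iff_exp_lt (by linarith)]
  linarith [Real.exp_one_lt_d9]

lemma eta_sq {τ : ℕ} {δ : ℝ} (hN : 2 ≤ N) (hδ0 : 0 < δ) (hδ1 : δ ≤ 1) :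
    eta N τ δ ^ 2 = (N : ℝ) / τ * Real.log (2 * N / δ) := by
  have := one_lt_log_ratio hN hδ0 hδ1
  exact Real.sq_sqrt (by positivity)

lemma eta_pos {τ : ℕ} {δ : ℝ} (hN : 2 ≤ N) (hτ : 1 ≤ τ) (hδ0 : 0 < δ) (hδ1 : δ ≤ 1) :
    0 < eta N τ δ := by
  have := one_lt_log_ratio hN hδ0 hδ1
  have : (0 : ℝ) < τ := by exact_mod_cast hτ
  have : (0 : ℝ) < N := by exact_mod_cast (by omega : 0 < N)
  exact Real.sqrt_pos.2 (by positivity)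

/-- Except with probability `δ`, all the empirical qualities are accurate up to `eta`. -/
lemma measure_inaccurate_le (A : Auction N K) (hK : 1 ≤ K) (hN : 2 ≤ N) (μ : unitInterval)
    {T τ : ℕ} {δ : ℝ} (hτ : 1 ≤ τ) (hτT : τ ≤ T) (hδ0 : 0 < δ) (hδ1 : δ ≤ 1) :
    (runLaw A μ T).real
      {ω | ∃ i, eta N τ δ < |qualityEstimate τ (fun r => (ω r).1) i - A.q i|} ≤ δ := by
  have hL := one_lt_log_ratio hN hδ0 hδ1
  have hτ' : (0 : ℝ) < τ := by exact_mod_cast hτ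
  have hN' : (0 : ℝ) < N := by exact_mod_cast (by omega : 0 < N)
  have hη := eta_pos hN hτ hδ0 hδ1
  rcases lt_or_ge τ N with hlt | hge
  · -- with less than `N` exploration rounds the confidence interval is trivial
    have h1 : 1 ≤ eta N τ δ := by
      refine Real.one_le_sqrt.2 ?_
      have : (1 : ℝ) ≤ N / τ := (one_le_div hτ').2 (by exact_mod_cast hlt.le)
      nlinarith
    have h2 : {ω : Run N K T |
        ∃ i, eta N τ δ < |qualityEstimate τ (fun r => (ω r).1) i - A.q i|} = ∅ := by
      refine Set.eq_empty_iff_forall_notMem.2 fun ω hω => ?_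
      obtain ⟨i, hi⟩ := hω
      have h3 := qualityEstimate_mem_Icc hK τ i ω
      have h4 : |qualityEstimate τ (fun r => (ω r).1) i - A.q i| ≤ 1 := by
        rw [abs_le]
        constructor <;> linarith [h3.1, h3.2, (A.q i).2.1, (A.q i).2.2]
      linarith
    rw [h2]; simpa using hδ0.le
  · have hdiv : 1 ≤ τ / N := (Nat.one_le_div_iff (by omega)).2 hge
    have h1 : ∀ i : Fin N, (runLaw A μ T).real
        {ω | eta N τ δ < |qualityEstimate τ (fun r => (ω r).1) i - A.q i|} ≤ δ / N := by
      intro i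
      set n := (firstSlotRounds τ i : Finset (Fin T)).card with hn
      have hcard : τ / N ≤ n := le_card_firstSlotRounds hτT i
      refine (measure_qualityEstimate_le A hK μ τ i hη.le hn.symm (by omega)).trans ?_
      have h2 : (τ : ℝ) ≤ 2 * n * N := by
        have : τ < N * (τ / N + 1) := Nat.lt_mul_div_succ _ (by omega)
        have h3 : N * (τ / N + 1) ≤ N * (n + n) := Nat.mul_le_mul_left _ (by omega)
        have h4 : τ ≤ N * (n + n) := by omega
        have h5 : (τ : ℝ) ≤ N * (n + n) := by exact_mod_cast h4
        linarith
      have h3 : Real.log (2 * N / δ) ≤ 2 * n * eta N τ δ ^ 2 := by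
        rw [eta_sq hN hδ0 hδ1]
        have : 1 ≤ 2 * n * N / (τ : ℝ) := (one_le_div hτ').2 h2
        calc Real.log (2 * N / δ) ≤ 2 * n * N / (τ : ℝ) * Real.log (2 * N / δ) :=
              le_mul_of_one_le_left (by linarith) this
          _ = _ := by ring
      calc 2 * Real.exp (-(2 * n * eta N τ δ ^ 2)) ≤ 2 * Real.exp (-Real.log (2 * N / δ)) := by
            gcongr
        _ = δ / N := by
            rw [Real.exp_neg, Real.exp_log (by positivity)]
            field_simp
    have hset : {ω : Run N K T |
        ∃ i, eta N τ δ < |qualityEstimate τ (fun r => (ω r).1) i - A.q i|} =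
        ⋃ i, {ω | eta N τ δ < |qualityEstimate τ (fun r => (ω r).1) i - A.q i|} := by
      ext; simp
    rw [hset]
    calc _ ≤ ∑ i : Fin N, (runLaw A μ T).real
          {ω | eta N τ δ < |qualityEstimate τ (fun r => (ω r).1) i - A.q i|} :=
          measureReal_iUnion_fintype_le _
      _ ≤ ∑ _ : Fin N, δ / N := Finset.sum_le_sum fun i _ => h1 i
      _ = δ := by simp; field_simp

/-! ### Expected revenue over a run -/

/-- The estimates that a run of the mechanism uses for ranking. -/
noncomputable def runEstimate {T : ℕ} (τ : ℕ) (δ : ℝ) (ω : Run N K T) : Fin N → ℝ :=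
  upperQuality τ δ fun r => (ω r).1

lemma measurable_qualityEstimate {T : ℕ} (τ : ℕ) (i : Fin N) :
    Measurable fun u : Fin T → User N K => qualityEstimate τ u i :=
  measurable_of_countable _

lemma measurable_users (T : ℕ) : Measurable fun (ω : Run N K T) (r : Fin T) => (ω r).1 :=
  measurable_pi_lambda _ fun r => measurable_fst.comp (measurable_pi_apply r)

lemma measurable_upperQuality {T : ℕ} (τ : ℕ) (δ : ℝ) :
    Measurable (upperQuality (N := N) (K := K) (T := T) τ δ) :=
  measurable_of_countable _

lemma measurable_runEstimate {T : ℕ} (τ : ℕ) (δ : ℝ) :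
    Measurable (runEstimate (N := N) (K := K) (T := T) τ δ) :=
  (measurable_upperQuality τ δ).comp (measurable_users T)

/-- The estimates depend on the exploration rounds only. -/
lemma indepFun_runEstimate (A : Auction N K) (μ : unitInterval) {T τ : ℕ} (δ : ℝ) {t : Fin T}
    (ht : τ ≤ t.val) :
    IndepFun (runEstimate τ δ) (fun ω : Run N K T => (ω t).2) (runLaw A μ T) := by
  classical
  set S : Finset (Fin T) := {r | r.val < τ} with hS
  have hind : iIndepFun (fun (r : Fin T) (ω : Run N K T) => ω r) (runLaw A μ T) :=
    iIndepFun_pi (X := fun _ r => r) fun _ => aemeasurable_id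
  have h1 := hind.indepFun_finset S {t} (by simp [hS, ht]) fun r => measurable_pi_apply r
  -- the estimates as a function of the exploration rounds; the other users are irrelevant
  let φ : (S → User N K × (Fin N → Seed)) → Fin N → ℝ := fun x => upperQuality τ δ
    fun r => if h : r ∈ S then (x ⟨r, h⟩).1 else (fun _ => true, fun _ => true)
  have hφ : Measurable φ := by
    refine (measurable_upperQuality τ δ).comp (measurable_pi_lambda _ fun r => ?_)
    by_cases h : r ∈ S
    · simp only [h, dif_pos]
      exact measurable_fst.comp (measurable_pi_apply _)
    · simp only [h, dif_neg, not_false_iff]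
      exact measurable_const
  have h2 := h1.comp hφ (measurable_snd.comp (measurable_pi_apply
    (⟨t, Finset.mem_singleton_self t⟩ : ({t} : Finset (Fin T)))))
  refine h2.congr (ae_of_all _ fun ω => ?_) (ae_of_all _ fun ω => rfl)
  ext i
  simp only [Function.comp, φ, runEstimate, upperQuality, qualityEstimate]
  congr 2
  refine Finset.sum_congr rfl fun r hr => ?_
  have : r ∈ S := by
    rw [hS, Finset.mem_filter_univ]
    exact (mem_firstSlotRounds.1 hr).1
  simp only [this, dif_pos]

lemma map_seeds (A : Auction N K) (μ : unitInterval) {T : ℕ} (t : Fin T) :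
    (runLaw A μ T).map (fun ω => (ω t).2) = seedsLaw N μ :=
  ((measurePreserving_snd (μ := userLaw A) (ν := seedsLaw N μ)).comp
    (measurePreserving_eval (fun _ : Fin T => (userLaw A).prod (seedsLaw N μ)) t)).map_eq

lemma abs_sum_netPayment_le (A : Auction N K) {vmax : ℝ} (hv : 0 ≤ vmax)
    (hbid : ∀ i, A.bid i ∈ Set.Icc 0 vmax) (μ : unitInterval) (e : Fin N → ℝ)
    (s : Fin N → Seed) : |∑ i, netPayment A f μ e s i| ≤ N * (vmax + 1 / μ * vmax) := by
  refine (Finset.abs_sum_le_sum_abs _ _).trans ?_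
  refine (Finset.sum_le_sum fun i _ => abs_netPayment_le A hv hbid μ e s i).trans ?_
  simp [mul_add]

lemma abs_roundRevenue_le (A : Auction N K) {vmax : ℝ} (hv : 0 ≤ vmax)
    (hbid : ∀ i, A.bid i ∈ Set.Icc 0 vmax) (μ : unitInterval) (e : Fin N → ℝ) :
    |roundRevenue A f μ e| ≤ N * (vmax + 1 / μ * vmax) := by
  have := norm_integral_le_of_norm_le_const (μ := seedsLaw N μ)
    (f := fun s => ∑ i, netPayment A f μ e s i) (ae_of_all _ fun s =>
      abs_sum_netPayment_le A hv hbid μ e s)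
  simpa [roundRevenue] using this

lemma IsRankingRule.measurable_sum_netPayment (hf : IsRankingRule f) (A : Auction N K)
    (μ : unitInterval) :
    Measurable fun p : (Fin N → ℝ) × (Fin N → Seed) => ∑ i, netPayment A f μ p.1 p.2 i :=
  Finset.measurable_sum _ fun i _ => hf.measurable_netPayment A μ i

lemma IsRankingRule.measurable_run_netPayment (hf : IsRankingRule f) (A : Auction N K)
    (μ : unitInterval) {T τ : ℕ} (δ : ℝ) (t : Fin T) :
    Measurable fun ω : Run N K T => ∑ i, netPayment A f μ (runEstimate τ δ ω) (ω t).2 i :=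
  Finset.measurable_sum _ fun i _ => (hf.measurable_netPayment A μ i).comp
    ((measurable_runEstimate τ δ).prodMk (measurable_snd.comp (measurable_pi_apply t)))

lemma IsRankingRule.measurable_roundRevenue (hf : IsRankingRule f) (A : Auction N K)
    (μ : unitInterval) : Measurable (roundRevenue A f μ) :=
  (StronglyMeasurable.integral_prod_right
    (hf.measurable_sum_netPayment A μ).stronglyMeasurable).measurable

lemma IsRankingRule.integral_sum_netPayment (hf : IsRankingRule f) (A : Auction N K) {vmax : ℝ}
    (hv : 0 ≤ vmax) (hbid : ∀ i, A.bid i ∈ Set.Icc 0 vmax) (μ : unitInterval) {T τ : ℕ} (δ : ℝ)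
    {t : Fin T} (ht : τ ≤ t.val) :
    ∫ ω, ∑ i, netPayment A f μ (runEstimate τ δ ω) (ω t).2 i ∂(runLaw A μ T) =
      ∫ ω, roundRevenue A f μ (runEstimate τ δ ω) ∂(runLaw A μ T) := by
  have hm := hf.measurable_sum_netPayment A μ
  have hE := measurable_runEstimate (N := N) (K := K) (T := T) τ δ
  have hY : Measurable fun ω : Run N K T => (ω t).2 := measurable_snd.comp (measurable_pi_apply t)
  have h1 := (indepFun_iff_map_prod_eq_prod_map_map hE.aemeasurable hY.aemeasurable).1
    (indepFun_runEstimate A μ δ ht)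
  rw [map_seeds] at h1
  have : IsProbabilityMeasure ((runLaw A μ T).map (runEstimate τ δ)) :=
    Measure.isProbabilityMeasure_map hE.aemeasurable
  rw [← integral_map (φ := fun ω : Run N K T => (runEstimate τ δ ω, (ω t).2))
      (f := fun p => ∑ i, netPayment A f μ p.1 p.2 i) (hE.prodMk hY).aemeasurable
      hm.aestronglyMeasurable, h1,
    integral_prod _ (integrable_of_bounded hm _ fun p => abs_sum_netPayment_le A hv hbid μ p.1 p.2)]
  exact integral_map hE.aemeasurable (hf.measurable_roundRevenue A μ).aestronglyMeasurable

/-- An exploitation round loses at most `vmax * K * (2 * η + μ * N + δ)` in expectation: when the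
estimates are inaccurate, the revenue is still nonnegative. -/
lemma IsRankingRule.le_integral_roundRevenue (hf : IsRankingRule f) (hK : 1 ≤ K) (hN : 2 ≤ N)
    (A : Auction N K) {vmax : ℝ} (hv : 0 ≤ vmax) (hbid : ∀ i, A.bid i ∈ Set.Icc 0 vmax)
    {θ : Allocation N} (hθ : A.IsEfficient θ) {μ : unitInterval} (hμ0 : 0 < μ) (hμ1 : μ < 1)
    {T τ : ℕ} {δ : ℝ} (hτ : 1 ≤ τ) (hτT : τ ≤ T) (hδ0 : 0 < δ) (hδ1 : δ ≤ 1) :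
    ∑ i, A.vcgPayment θ i - vmax * K * (2 * eta N τ δ + μ * N + δ) ≤
      ∫ ω, roundRevenue A f μ (runEstimate τ δ ω) ∂(runLaw A μ T) := by
  have hη := eta_pos (τ := τ) hN hτ hδ0 hδ1
  set c := ∑ i, A.vcgPayment θ i - vmax * K * (2 * eta N τ δ + μ * N) with hc
  have hvK : 0 ≤ vmax * K := by positivity
  set B : Set (Run N K T) :=
    {ω | ∃ i, eta N τ δ < |qualityEstimate τ (fun r => (ω r).1) i - A.q i|} with hB
  have hBm : MeasurableSet B := by
    have : B = ⋃ i, {ω | eta N τ δ < |qualityEstimate τ (fun r => (ω r).1) i - A.q i|} := by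
      ext; simp [hB]
    rw [this]
    refine MeasurableSet.iUnion fun i => measurableSet_lt measurable_const ?_
    exact (((measurable_qualityEstimate τ i).comp (measurable_users T)).sub_const _).abs
  have hBδ : (runLaw A μ T).real B ≤ δ := measure_inaccurate_le A hK hN μ hτ hτT hδ0 hδ1
  have hpt : ∀ ω : Run N K T, c - B.indicator (fun _ => vmax * K) ω ≤
      roundRevenue A f μ (runEstimate τ δ ω) := by
    intro ω
    have he : ∀ i, 0 < runEstimate τ δ ω i := fun i =>
      add_pos_of_nonneg_of_pos (qualityEstimate_mem_Icc hK τ i ω).1 hη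
    by_cases hω : ω ∈ B
    · rw [Set.indicator_of_mem hω]
      have h1 := hf.roundRevenue_nonneg A hv hbid hμ0 hμ1 he
      have h2 := A.sum_vcgPayment_le_mul hv hbid hθ
      have h3 : 0 ≤ vmax * K * (2 * eta N τ δ + μ * N) :=
        mul_nonneg hvK (add_nonneg (by positivity) (mul_nonneg μ.2.1 (Nat.cast_nonneg _)))
      linarith
    · rw [Set.indicator_of_notMem hω, sub_zero]
      have hω' : ∀ i, |qualityEstimate τ (fun r => (ω r).1) i - A.q i| ≤ eta N τ δ :=
        fun i => not_lt.1 fun h => hω ⟨i, h⟩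
      refine hf.le_roundRevenue A hv hbid hθ hμ0 hμ1 he hη.le (fun i => ?_) fun i => ?_
      · have := (abs_le.1 (hω' i)).1
        simp only [runEstimate, upperQuality]
        linarith
      · have := (abs_le.1 (hω' i)).2
        simp only [runEstimate, upperQuality]
        linarith
  have hi : Integrable (B.indicator fun _ => vmax * K) (runLaw A μ T) :=
    (integrable_const _).indicator hBm
  have hmono := integral_mono ((integrable_const c).sub hi)
    (integrable_of_bounded ((hf.measurable_roundRevenue A μ).comp (measurable_runEstimate τ δ)) _
      fun ω => abs_roundRevenue_le A hv hbid μ _) hpt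
  rw [integral_sub' (integrable_const c) hi, integral_indicator_const _ hBm] at hmono
  simp only [integral_const, probReal_univ, smul_eq_mul, one_mul] at hmono
  have h4 : (runLaw A μ T).real B * (vmax * K) ≤ δ * (vmax * K) :=
    mul_le_mul_of_nonneg_right hBδ hvK
  have h5 : c - δ * (vmax * K) ≤ ∫ ω, roundRevenue A f μ (runEstimate τ δ ω) ∂(runLaw A μ T) :=
    (sub_le_sub_left h4 c).trans hmono
  refine le_trans (le_of_eq ?_) h5
  rw [hc]; ring

/-- The regret bound, with the sharper constant `1` in front of `μ * N`. -/
theorem IsRankingRule.regret_le (hf : IsRankingRule f) (hK : 1 ≤ K) (hN : 2 ≤ N)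
    (A : Auction N K) {vmax : ℝ} (hv : 0 ≤ vmax) (hbid : ∀ i, A.bid i ∈ Set.Icc 0 vmax)
    {θ : Allocation N} (hθ : A.IsEfficient θ) {μ : unitInterval} (hμ0 : 0 < μ) (hμ1 : μ < 1)
    {T τ : ℕ} {δ : ℝ} (hτ : 1 ≤ τ) (hτT : τ ≤ T) (hδ0 : 0 < δ) (hδ1 : δ ≤ 1) :
    regret A θ f μ T τ δ ≤ vmax * K * ((T - τ) * (2 * eta N τ δ + μ * N) + τ + δ * T) := by
  set V := ∑ i, A.vcgPayment θ i with hV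
  set x := V - vmax * K * (2 * eta N τ δ + μ * N + δ) with hx
  have hvK : 0 ≤ vmax * K := by positivity
  have hround : ∀ (t : Fin T) (ω : Run N K T), ∑ i, roundPayment A f μ τ δ i t ω =
      if t.val < τ then 0 else ∑ i, netPayment A f μ (runEstimate τ δ ω) (ω t).2 i := by
    intro t ω
    unfold roundPayment
    split_ifs with h
    · simp
    · exact Finset.sum_congr rfl fun i _ => integral_clickPayment A f μ _ _ i
  have hint : ∀ t : Fin T, Integrable (fun ω => ∑ i, roundPayment A f μ τ δ i t ω)
      (runLaw A μ T) := by
    intro t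
    simp only [hround]
    split_ifs with h
    · exact integrable_zero _ _ _
    · exact integrable_of_bounded (hf.measurable_run_netPayment A μ δ t) _
        fun ω => abs_sum_netPayment_le A hv hbid μ (runEstimate τ δ ω) (ω t).2
  have hlow : ∀ t : Fin T, x - (if t.val < τ then x else 0) ≤
      ∫ ω, ∑ i, roundPayment A f μ τ δ i t ω ∂(runLaw A μ T) := by
    intro t
    simp only [hround]
    split_ifs with h
    · simp
    · rw [hf.integral_sum_netPayment A hv hbid μ δ (not_lt.1 h), sub_zero]
      exact hf.le_integral_roundRevenue hK hN A hv hbid hθ hμ0 hμ1 hτ hτT hδ0 hδ1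
  have hcard : ∑ t : Fin T, (if t.val < τ then x else 0) = τ * x := by
    rw [Fin.sum_univ_eq_sum_range (fun t => if t < τ then x else 0) T, ← Finset.sum_filter]
    have : (Finset.range T).filter (fun t => t < τ) = Finset.range τ := by
      ext t; simp only [Finset.mem_filter, Finset.mem_range]; omega
    rw [this]; simp
  have hsum := Finset.sum_le_sum fun t (_ : t ∈ Finset.univ) => hlow t
  rw [Finset.sum_sub_distrib, hcard, Finset.sum_const, Finset.card_univ, Fintype.card_fin,
    nsmul_eq_mul] at hsum
  have hreg : regret A θ f μ T τ δ =
      T * V - ∑ t : Fin T, ∫ ω, ∑ i, roundPayment A f μ τ δ i t ω ∂(runLaw A μ T) := by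
    unfold regret
    rw [integral_sub (integrable_const _) (integrable_finsetSum _ fun t _ => hint t),
      integral_finsetSum _ fun t _ => hint t]
    simp [hV]
  have hVK := A.sum_vcgPayment_le_mul hv hbid hθ
  have hτ0 : (0 : ℝ) ≤ τ := Nat.cast_nonneg _
  have h1 : (τ : ℝ) * V ≤ τ * (vmax * K) := mul_le_mul_of_nonneg_left hVK hτ0
  have h2 : 0 ≤ (τ : ℝ) * δ * (vmax * K) := by positivity
  have h3 : (T : ℝ) * x - τ * x = (T - τ) * V -
      (vmax * K) * ((T - τ) * (2 * eta N τ δ + μ * N)) - (T - τ) * δ * (vmax * K) := by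
    rw [hx]; ring
  have h4 : vmax * K * ((T - τ) * (2 * eta N τ δ + μ * N) + τ + δ * T) =
    vmax * K * ((T - τ) * (2 * eta N τ δ + μ * N)) + τ * (vmax * K) + δ * T * (vmax * K) := by ring
  rw [h4, hreg]
  nlinarith

/-! ### Choice of the parameters -/

/-- With `a = N ^ (1 / 3)`, `t = T ^ (1 / 3)` and `l` the cube root of the logarithm, the optimal
length of the exploration phase is about `t ^ 2 * a * l`, and each term of the regret bound is of
that order. -/
lemma regret_parameters_le {a t l η : ℝ} {τ : ℕ} (ha : 0 < a) (hat : 2 ≤ a * t ^ 2) (ht : 0 < t)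
    (hl : 1 ≤ l) (hτT : (τ : ℝ) ≤ t ^ 3) (hT : ∃ T : ℕ, (T : ℝ) = t ^ 3)
    (hτ : |(τ : ℝ) - min (t ^ 2 * a * l) (t ^ 3)| < 1) (hη0 : 0 ≤ η)
    (hη : η ^ 2 = a ^ 3 / τ * l ^ 3) :
    (t ^ 3 - τ) * (2 * η + (a ^ 2 * t)⁻¹ * a ^ 3) + τ + a / t * t ^ 3 ≤ 6 * (t ^ 2 * a * l) := by
  obtain ⟨T, hT⟩ := hT
  set S := t ^ 2 * a * l with hS
  have hSa : a * t ^ 2 ≤ S := by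
    rw [hS, mul_comm a]
    exact le_mul_of_one_le_right (by positivity) hl
  have hδT : a / t * t ^ 3 = a * t ^ 2 := by field_simp
  have hμN : (a ^ 2 * t)⁻¹ * a ^ 3 * t ^ 3 = a * t ^ 2 := by field_simp
  rw [hδT]
  have h0 := abs_lt.1 hτ
  rcases le_total (t ^ 3) S with h | h
  · -- the whole run is spent exploring
    rw [min_eq_right h] at h0
    have h1 : (T : ℝ) < τ + 1 := by rw [hT]; linarith [h0.1]
    have h2 : T ≤ τ := by
      have : T < τ + 1 := by exact_mod_cast h1
      omega
    have h3 : (τ : ℝ) = t ^ 3 := le_antisymm hτT (by rw [← hT]; exact_mod_cast h2)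
    rw [h3, sub_self, zero_mul, zero_add]
    linarith
  · rw [min_eq_left h] at h0
    have h1 : 2 ≤ τ := by
      have : (1 : ℝ) < τ := by linarith [h0.1]
      have : 1 < τ := by exact_mod_cast this
      omega
    have h1' : (2 : ℝ) ≤ τ := by exact_mod_cast h1
    have hτ0 : (0 : ℝ) < τ := by linarith
    have h2 : S ≤ 3 / 2 * τ := by linarith [h0.1]
    have hS0 : 0 < S := by linarith
    have h3 : (t ^ 3 * η) ^ 2 ≤ 3 / 2 * S ^ 2 := by
      have : (t ^ 3 * η) ^ 2 = S ^ 3 / τ := by rw [mul_pow, hη, hS]; ring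
      rw [this, div_le_iff₀ hτ0]
      nlinarith [mul_le_mul_of_nonneg_left h2 (sq_nonneg S)]
    -- `49 / 40` is slightly above the square root of `3 / 2`
    have h4 : t ^ 3 * η ≤ 49 / 40 * S := by
      refine le_of_sq_le_sq ?_ (by positivity)
      nlinarith [sq_nonneg S]
    have h5 : 0 ≤ (τ : ℝ) * (2 * η + (a ^ 2 * t)⁻¹ * a ^ 3) := by positivity
    have h6 : (t ^ 3 - τ) * (2 * η + (a ^ 2 * t)⁻¹ * a ^ 3) ≤ 2 * (t ^ 3 * η) + a * t ^ 2 := by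
      rw [← hμN]; linarith
    linarith [h0.2]

end AVCG3

theorem mainTheorem3 {N K : ℕ} (hK : 1 ≤ K) (hKN : K < N) (A : AVCG3.Auction N K) (vmax : ℝ)
    (hbid : ∀ i, A.bid i ∈ Set.Icc 0 vmax)
    (θ : AVCG3.Allocation N) (hθ : A.IsEfficient θ)
    (f : (Fin N → ℝ) → (Fin N → ℝ) → AVCG3.Allocation N) (hf : AVCG3.IsRankingRule f) (T : ℕ) :
    (∀ (τ : ℕ) (δ : ℝ) (μ : unitInterval), 1 ≤ τ → τ ≤ T → 0 < δ → δ ≤ 1 → 0 < μ → μ < 1 →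
      AVCG3.regret A θ f μ T τ δ ≤
        vmax * K * ((T - τ) * (2 * AVCG3.eta N τ δ + 2 * μ * N) + τ + δ * T)) ∧
    (N ≤ T → ∀ (τ : ℕ) (δ : ℝ) (μ : unitInterval),
      (μ : ℝ) = (N : ℝ) ^ (-2 / 3 : ℝ) * (T : ℝ) ^ (-1 / 3 : ℝ) →
      δ = (N : ℝ) ^ (1 / 3 : ℝ) * (T : ℝ) ^ (-1 / 3 : ℝ) →
      τ ≤ T →
      |(τ : ℝ) - min ((T : ℝ) ^ (2 / 3 : ℝ) * (N : ℝ) ^ (1 / 3 : ℝ) *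
          Real.log (2 * N / δ) ^ (1 / 3 : ℝ)) T| < 1 →
      AVCG3.regret A θ f μ T τ δ ≤
        6 * vmax * K * (T : ℝ) ^ (2 / 3 : ℝ) * (N : ℝ) ^ (1 / 3 : ℝ) *
          Real.log (2 * (N : ℝ) ^ (2 / 3 : ℝ) * (T : ℝ) ^ (1 / 3 : ℝ)) ^ (1 / 3 : ℝ)) := by
  have hN : 2 ≤ N := by omega
  have hv : 0 ≤ vmax := (hbid ⟨0, by omega⟩).1.trans (hbid ⟨0, by omega⟩).2
  have hvK : 0 ≤ vmax * K := by positivity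
  refine ⟨fun τ δ μ hτ hτT hδ0 hδ1 hμ0 hμ1 => ?_, fun hNT τ δ μ hμ hδ hτT hτ => ?_⟩
  · refine (hf.regret_le hK hN A hv hbid hθ hμ0 hμ1 hτ hτT hδ0 hδ1).trans ?_
    have h1 : (0 : ℝ) ≤ T - τ := sub_nonneg.2 (by exact_mod_cast hτT)
    have h2 : (0 : ℝ) ≤ μ * N := mul_nonneg μ.2.1 (Nat.cast_nonneg _)
    refine mul_le_mul_of_nonneg_left ?_ hvK
    gcongr
    linarith [μ.2.1]
  -- the cube roots of `N`, `T` and the logarithm turn the claim into a polynomial inequality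
  · have hN' : (2 : ℝ) ≤ N := by exact_mod_cast hN
    have hNT' : (N : ℝ) ≤ T := by exact_mod_cast hNT
    have hN0 : (0 : ℝ) ≤ N := by linarith
    have hT0 : (0 : ℝ) ≤ T := by linarith
    set a : ℝ := (N : ℝ) ^ (1 / 3 : ℝ) with ha
    set t : ℝ := (T : ℝ) ^ (1 / 3 : ℝ) with ht
    have ha3 : a ^ 3 = N := by
      rw [ha, ← Real.rpow_natCast, ← Real.rpow_mul hN0]; norm_num
    have ht3 : t ^ 3 = T := by
      rw [ht, ← Real.rpow_natCast, ← Real.rpow_mul hT0]; norm_num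
    have hNa : (N : ℝ) ^ (2 / 3 : ℝ) = a ^ 2 := by
      rw [ha, ← Real.rpow_natCast, ← Real.rpow_mul hN0]; norm_num
    have hTt : (T : ℝ) ^ (2 / 3 : ℝ) = t ^ 2 := by
      rw [ht, ← Real.rpow_natCast, ← Real.rpow_mul hT0]; norm_num
    have hNa' : (N : ℝ) ^ (-2 / 3 : ℝ) = (a ^ 2)⁻¹ := by
      rw [← hNa, ← Real.rpow_neg hN0]; norm_num
    have hTt' : (T : ℝ) ^ (-1 / 3 : ℝ) = t⁻¹ := by
      rw [ht, ← Real.rpow_neg hT0]; norm_num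
    have ha0 : 0 < a := Real.rpow_pos_of_pos (by linarith) _
    have ht0 : 0 < t := Real.rpow_pos_of_pos (by linarith) _
    have hat : a ≤ t := Real.rpow_le_rpow hN0 hNT' (by norm_num)
    have ha1 : 1 < a := Real.one_lt_rpow (by linarith) (by norm_num)
    rw [hTt'] at hδ hμ
    rw [hNa', ← mul_inv] at hμ
    rw [← div_eq_mul_inv] at hδ
    have hδ0 : 0 < δ := by rw [hδ]; positivity
    have hδ1 : δ ≤ 1 := by rw [hδ]; exact (div_le_one ht0).2 hat
    have hμ0 : 0 < μ := by
      rw [← Subtype.coe_lt_coe, hμ]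
      exact inv_pos.2 (by positivity)
    have hμ1 : μ < 1 := by
      rw [← Subtype.coe_lt_coe, hμ]
      exact inv_lt_one_of_one_lt₀ (by nlinarith)
    have hL : Real.log (2 * (N : ℝ) ^ (2 / 3 : ℝ) * t) = Real.log (2 * N / δ) := by
      rw [hNa, hδ, ← ha3]
      congr 1
      field_simp
    have hL1 := AVCG3.one_lt_log_ratio hN hδ0 hδ1
    rw [hL, hTt]
    rw [hTt] at hτ
    set l : ℝ := Real.log (2 * N / δ) ^ (1 / 3 : ℝ) with hl
    have hl3 : l ^ 3 = Real.log (2 * N / δ) := by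
      rw [hl, ← Real.rpow_natCast, ← Real.rpow_mul (by linarith)]; norm_num
    have hl1 : 1 ≤ l := Real.one_le_rpow hL1.le (by norm_num)
    have hat2 : 2 ≤ a * t ^ 2 := by
      calc (2 : ℝ) ≤ N := hN'
        _ = a * a ^ 2 := by rw [← ha3]; ring
        _ ≤ a * t ^ 2 := by gcongr
    have hS : 2 ≤ t ^ 2 * a * l := by
      rw [mul_comm (t ^ 2)]
      exact hat2.trans (le_mul_of_one_le_right (by positivity) hl1)
    have hτ1 : 1 ≤ τ := by
      have h1 : (2 : ℝ) ≤ min (t ^ 2 * a * l) T := le_min hS (by linarith)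
      have h2 : (1 : ℝ) < τ := by linarith [(abs_lt.1 hτ).1]
      exact_mod_cast h2.le
    have h1 := hf.regret_le hK hN A hv hbid hθ hμ0 hμ1 hτ1 hτT hδ0 hδ1
    have h2 := AVCG3.regret_parameters_le (τ := τ) ha0 hat2 ht0 hl1
      (by rw [ht3]; exact_mod_cast hτT) ⟨T, ht3.symm⟩ (by rw [ht3]; exact hτ)
      (AVCG3.eta_pos hN hτ1 hδ0 hδ1).le
      (by rw [AVCG3.eta_sq hN hδ0 hδ1, ha3, hl3])
    rw [ht3, ha3, ← hμ, ← hδ] at h2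
    calc _ ≤ _ := h1
      _ ≤ vmax * K * (6 * (t ^ 2 * a * l)) := mul_le_mul_of_nonneg_left h2 hvK
      _ = _ := by ring
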